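/- Let $\eta(\tau)=e^{2\pi i\tau/24}\prod_{n\ge 1}(1-e^{2\pi i n\tau})$ be the Dedekind eta function on the upper half plane, and for a function $f$ on the upper half plane put $$L(f,s)=\frac{(2\pi)^s}{\Gamma(s)}\int_0^\infty f(ix)\,x^{s}\,\frac{dx}{x}$$ whenever the integral converges absolutely. Let $(a)_n=a(a+1)\cdots(a+n-1)$, and let $${}_pF_q(a_1,\dots,a_p;b_1,\dots,b_q;z)=\sum_{n\ge 0}\frac{(a_1)_n\cdots(a_p)_n}{(b_1)_n\cdots(b_q)_n}\frac{z^n}{n!}$$ be the generalized hypergeometric series. Then, for $f(\tau)=\eta(2\tau)^{12}$, the integral defining $L(f,5)$ and both series below converge absolutely, and $$L(f,5)=\frac{\pi^6}{1024}\sum_{n\ge 0}\frac{(\frac12)_n^8}{(1)_n^8}(1+4n)=\frac{\pi^6}{1024}\;{}_9F_8\!\left(\tfrac12,\tfrac12,\tfrac12,\tfrac12,\tfrac12,\tfrac12,\tfrac12,\tfrac12,\tfrac54;\;1,1,1,1,1,1,1,\tfrac14;\;1\right).$$ -/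

import Mathlib

open UpperHalfPlane hiding I
open scoped Real Nat

noncomputable section

/-- The function `τ ↦ η(2τ)¹²` on the upper half plane, with `η` the Dedekind eta function. -/
def etaTwoPowTwelve (τ : ℍ) : ℂ := ModularForm.eta (2 * (τ : ℂ)) ^ 12

/-- Convergence (absolute integrability) of the integral `∫₀^∞ f(ix) x^s dx/x`. -/
def LIntegralConverges (f : ℍ → ℂ) (s : ℂ) : Prop :=
  MellinConvergent (fun x : ℝ => f (ofComplex (Complex.I * x))) s

/-- The `L`-function `L(f, s) = (2π)^s / Γ(s) * ∫₀^∞ f(ix) x^s dx/x` of a function `f` on the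
upper half plane. For `x > 0`, `ofComplex (I * x)` is the point `ix` of the upper half plane. -/
def LValue (f : ℍ → ℂ) (s : ℂ) : ℂ :=
  (2 * (π : ℂ)) ^ s / Complex.Gamma s *
    mellin (fun x : ℝ => f (ofComplex (Complex.I * x))) s

/-- The rising factorial (Pochhammer symbol) `(a)_n = a (a + 1) ⋯ (a + n - 1)`. -/
def risingFactorial (a : ℂ) (n : ℕ) : ℂ := (ascPochhammer ℂ n).eval a

/-- The `n`-th term `(a₁)_n ⋯ (a_p)_n / ((b₁)_n ⋯ (b_q)_n) * z^n / n!` of the generalized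
hypergeometric series with upper parameters `a` and lower parameters `b`. -/
def hypergeometricTerm (a b : Multiset ℂ) (z : ℂ) (n : ℕ) : ℂ :=
  (a.map fun x => risingFactorial x n).prod / (b.map fun y => risingFactorial y n).prod *
    (z ^ n / (n ! : ℂ))

/-- The generalized hypergeometric series `_pF_q(a; b; z)`. -/
def hypergeometricPFQ (a b : Multiset ℂ) (z : ℂ) : ℂ := ∑' n : ℕ, hypergeometricTerm a b z n

end

noncomputable section

open Filter Set Topology MeasureTheory Asymptotics

/-!
Let `F = ₂F₁(1/2, 1/2; 1; ·)` and `M(s) = ∫₀^∞ η(iy)¹² y^(s - 1) dy`. The weight six form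
`η¹²` is invariant under the map `τ ↦ 1 / (1 - τ)` of order three. Its period polynomial is
therefore constrained, which gives the Eichler-Shimura relation `2 M(5) = 3 M(3)`.

In the parameter `t = λ(iy)` one has `F(t) = θ₃(iy)²` and `F(1 - t) / F(t) = y`, and Legendre's
relation turns `M(3)` into `1 / (16 π)` times the integral of `W(t)² = (F(t) F(1 - t))²` over
`[0, 1]`. Expand `W` in shifted Legendre polynomials. It satisfies a third-order differential
equation, which implies the two-term recurrence `(n + 2)⁴ a (n + 2) = (n + 1)⁴ a n` for its
coefficients. The odd ones vanish by the symmetry `t ↦ 1 - t` and the even ones are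
`(π / 2) ((1/2)_n / n!)⁴`, so Parseval's identity evaluates the integral as the hypergeometric
series.
-/

/-! ### The series `₂F₁(1/2, 1/2; 1; t)` -/

section PowerSeries

variable {c : ℕ → ℝ} {C t : ℝ}

theorem summable_mul_pow_of_bounded (hc : ∀ n, |c n| ≤ C) (ht : |t| < 1) :
    Summable fun n => c n * t ^ n := by
  refine .of_norm_bounded
    ((summable_geometric_of_abs_lt_one (r := |t|) (by rwa [abs_abs])).mul_left C) fun n => ?_
  rw [Real.norm_eq_abs, abs_mul, abs_pow]
  gcongr
  exact hc n

theorem mul_tsum_succ_mul_pow (h0 : c 0 = 0) (hs : Summable fun n => c n * t ^ n) :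
    t * ∑' n, c (n + 1) * t ^ n = ∑' n, c n * t ^ n := by
  rw [hs.tsum_eq_zero_add, h0, zero_mul, zero_add, ← tsum_mul_left]
  exact tsum_congr fun n => by ring

theorem hasDerivAt_tsum_mul_pow_of_bounded (hc : ∀ n, |c n| ≤ C) (ht : |t| < 1) :
    HasDerivAt (fun x => ∑' n, c n * x ^ n) (∑' n : ℕ, (n + 1) * c (n + 1) * t ^ n) t := by
  obtain ⟨r, htr, hr1⟩ := exists_between ht
  have hr0 : 0 < r := (abs_nonneg t).trans_lt htr
  have hgeom : Summable fun n : ℕ => (n : ℝ) * r ^ (n - 1) := by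
    refine ((summable_pow_mul_geometric_of_norm_lt_one 1
      (by rwa [Real.norm_eq_abs, abs_of_pos hr0])).mul_right r⁻¹).congr fun n => ?_
    rcases n with _ | n
    · simp
    · rw [pow_one, Nat.add_sub_cancel, pow_succ, mul_assoc, mul_inv_cancel_right₀ hr0.ne']
  have hbound : ∀ (n : ℕ), ∀ y ∈ Metric.ball (0 : ℝ) r,
      ‖c n * (n * y ^ (n - 1))‖ ≤ C * (n * r ^ (n - 1)) := fun n y hy => by
    have hy' : |y| < r := by simpa using hy
    rw [Real.norm_eq_abs, abs_mul, abs_mul, abs_pow, Nat.abs_cast]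
    have hC : 0 ≤ C := (abs_nonneg _).trans (hc n)
    gcongr
    exact hc n
  have htmem : t ∈ Metric.ball (0 : ℝ) r := by simpa using htr
  have hderiv := hasDerivAt_tsum_of_isPreconnected (hgeom.mul_left C) Metric.isOpen_ball
    (convex_ball (0 : ℝ) r).isPreconnected
    (fun n y _ => (hasDerivAt_pow n y).const_mul (c n)) hbound htmem
    (summable_mul_pow_of_bounded hc ht) htmem
  refine hderiv.congr_deriv ?_
  rw [(Summable.of_norm_bounded (hgeom.mul_left C) fun n => hbound n t htmem).tsum_eq_zero_add]
  simp only [Nat.cast_zero, zero_mul, mul_zero, zero_add, Nat.add_sub_cancel, Nat.cast_succ]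
  exact tsum_congr fun n => by ring

end PowerSeries

/-- The Wallis ratio `(1/2)_n / n! = (2n - 1)!! / (2n)!!`. -/
def wallisRatio (n : ℕ) : ℝ := n.centralBinom / 4 ^ n

@[simp]
theorem wallisRatio_zero : wallisRatio 0 = 1 := by simp [wallisRatio]

theorem wallisRatio_pos (n : ℕ) : 0 < wallisRatio n :=
  div_pos (Nat.cast_pos.2 n.centralBinom_pos) (by positivity)

theorem succ_mul_wallisRatio_succ (n : ℕ) :
    (n + 1) * wallisRatio (n + 1) = (n + 1 / 2) * wallisRatio n := by
  have h : ((n : ℝ) + 1) * (n + 1).centralBinom = 2 * (2 * n + 1) * n.centralBinom := by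
    exact_mod_cast Nat.succ_mul_centralBinom_succ n
  rw [wallisRatio, wallisRatio, ← mul_div_assoc, h, pow_succ]
  field

theorem wallisRatio_succ (n : ℕ) :
    wallisRatio (n + 1) = (n + 1 / 2) / (n + 1) * wallisRatio n := by
  rw [div_mul_eq_mul_div, eq_div_iff (by positivity), mul_comm, succ_mul_wallisRatio_succ]

theorem wallisRatio_le_one (n : ℕ) : wallisRatio n ≤ 1 := by
  induction n with
  | zero => simp
  | succ n ih =>
    rw [wallisRatio_succ]
    refine mul_le_one₀ ?_ (wallisRatio_pos n).le ih
    rw [div_le_one (by positivity)]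
    linarith

theorem abs_wallisRatio_sq_le (n : ℕ) : |wallisRatio n ^ 2| ≤ 1 := by
  rw [abs_of_nonneg (by positivity)]
  exact pow_le_one₀ (wallisRatio_pos n).le (wallisRatio_le_one n)

theorem wallisRatio_sq_mul_wallis (n : ℕ) :
    wallisRatio n ^ 2 * (2 * n + 1) * Real.Wallis.W n = 1 := by
  induction n with
  | zero => simp [Real.Wallis.W]
  | succ n ih =>
    rw [Real.Wallis.W_succ, wallisRatio_succ]
    refine Eq.trans ?_ ih
    push_cast
    field

theorem tendsto_mul_wallisRatio_sq :
    Tendsto (fun n : ℕ => n * wallisRatio n ^ 2) atTop (𝓝 (1 / π)) := by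
  have hhalf : Tendsto (fun n : ℕ => (n : ℝ) / (2 * n + 1)) atTop (𝓝 (1 / 2)) := by
    have h : Tendsto (fun n : ℕ => (2 + (n : ℝ)⁻¹)⁻¹) atTop (𝓝 (2 + 0)⁻¹) :=
      (tendsto_const_nhds.add tendsto_inv_atTop_nhds_zero_nat).inv₀ (by norm_num)
    rw [add_zero, ← one_div] at h
    refine h.congr' ?_
    filter_upwards [eventually_gt_atTop 0] with n hn
    field
  have hlim := hhalf.mul (Real.Wallis.tendsto_W_nhds_pi_div_two.inv₀ (by positivity))
  refine (hlim.congr fun n => ?_).trans_eq (by field_simp)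
  have hW := Real.Wallis.W_pos n
  field_simp
  linear_combination (-(n : ℝ)) * wallisRatio_sq_mul_wallis n

theorem sum_wallisRatio_sq_div (n : ℕ) :
    ∑ k ∈ Finset.range n, wallisRatio k ^ 2 / (4 * (k + 1)) = n * wallisRatio n ^ 2 := by
  induction n with
  | zero => simp
  | succ n ih =>
    rw [Finset.sum_range_succ, ih, wallisRatio_succ]
    push_cast
    field

theorem hasSum_wallisRatio_sq_div :
    HasSum (fun k : ℕ => wallisRatio k ^ 2 / (4 * (k + 1))) (1 / π) := by
  rw [hasSum_iff_tendsto_nat_of_nonneg (fun k => by positivity)]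
  simpa only [sum_wallisRatio_sq_div] using tendsto_mul_wallisRatio_sq

theorem mul_wallisRatio_sq_le_one (n : ℕ) : n * wallisRatio n ^ 2 ≤ 1 := by
  rw [← sum_wallisRatio_sq_div]
  refine (sum_le_hasSum _ (fun k _ => by positivity) hasSum_wallisRatio_sq_div).trans ?_
  rw [div_le_one Real.pi_pos]
  linarith [Real.pi_gt_three]

theorem abs_wallisRatio_sq_div_le (n : ℕ) : |wallisRatio n ^ 2 / (4 * ((n : ℝ) + 1))| ≤ 1 := by
  rw [abs_div]
  refine div_le_one_of_le₀ ((abs_wallisRatio_sq_le n).trans ?_) (abs_nonneg _)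
  rw [abs_of_pos (by positivity)]
  linarith [(n.cast_nonneg : (0 : ℝ) ≤ n)]

/-- The series `₂F₁(1/2, 1/2; 1; t)`, that is, `2 K / π` as a function of the parameter `t = k²`. -/
def ellF (t : ℝ) : ℝ := ∑' n, wallisRatio n ^ 2 * t ^ n

/-- The companion series of `ellF`, equal to `(1 - t) F'(t)`. Together `F` and `t G` satisfy the
first-order system `F' = t G / (t (1 - t))`, `(t G)' = F / 4`. -/
def ellG (t : ℝ) : ℝ := ∑' n : ℕ, wallisRatio n ^ 2 / (4 * (n + 1)) * t ^ n

theorem hasDerivAt_ellF {t : ℝ} (ht : |t| < 1) : HasDerivAt ellF (ellG t / (1 - t)) t := by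
  refine (hasDerivAt_tsum_mul_pow_of_bounded abs_wallisRatio_sq_le ht).congr_deriv ?_
  have hbound : ∀ n : ℕ, |(n : ℝ) * wallisRatio n ^ 2| ≤ 1 := fun n => by
    rw [abs_of_nonneg (by positivity)]
    exact mul_wallisRatio_sq_le_one n
  have hs := summable_mul_pow_of_bounded hbound ht
  have hs' := summable_mul_pow_of_bounded (fun n => hbound (n + 1)) ht
  have hshift := mul_tsum_succ_mul_pow (by simp) hs
  simp only [Nat.cast_succ] at hs' hshift
  rw [eq_div_iff (by linarith [(abs_lt.1 ht).2]), mul_comm, sub_mul, one_mul, hshift,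
    ← hs'.tsum_sub hs]
  refine tsum_congr fun n => ?_
  rw [wallisRatio_succ]
  field

theorem hasDerivAt_mul_ellG {t : ℝ} (ht : |t| < 1) :
    HasDerivAt (fun t => t * ellG t) (ellF t / 4) t := by
  refine ((hasDerivAt_id t).mul
    (hasDerivAt_tsum_mul_pow_of_bounded abs_wallisRatio_sq_div_le ht)).congr_deriv ?_
  have hbound : ∀ n : ℕ, |(n : ℝ) * (wallisRatio n ^ 2 / (4 * ((n : ℝ) + 1)))| ≤ 1 := fun n => by
    rw [abs_of_nonneg (by positivity), mul_div_assoc', div_le_one (by positivity)]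
    linarith [mul_wallisRatio_sq_le_one n, (n.cast_nonneg : (0 : ℝ) ≤ n)]
  have hs := summable_mul_pow_of_bounded hbound ht
  have hshift := mul_tsum_succ_mul_pow (by simp) hs
  simp only [Nat.cast_succ] at hshift
  simp only [id, one_mul, Nat.cast_succ]
  rw [hshift, ← (summable_mul_pow_of_bounded abs_wallisRatio_sq_div_le ht).tsum_add hs, ellF,
    ← tsum_div_const]
  exact tsum_congr fun n => by field

theorem continuousOn_ellG : ContinuousOn ellG (Icc 0 1) := by
  refine continuousOn_tsum (u := fun n : ℕ => wallisRatio n ^ 2 / (4 * (n + 1)))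
    (fun n => by fun_prop) hasSum_wallisRatio_sq_div.summable fun n x hx => ?_
  rw [Real.norm_eq_abs, abs_of_nonneg (by have := hx.1; positivity)]
  exact mul_le_of_le_one_right (by positivity) (pow_le_one₀ hx.1 hx.2)

theorem ellG_one : ellG 1 = 1 / π := by
  simpa [ellG] using hasSum_wallisRatio_sq_div.tsum_eq

theorem ellF_zero : ellF 0 = 1 := by
  rw [ellF, tsum_eq_single 0 fun n hn => by simp [hn]]
  simp

theorem one_le_ellF {t : ℝ} (h0 : 0 ≤ t) (h1 : t < 1) : 1 ≤ ellF t := by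
  simpa [ellF] using (summable_mul_pow_of_bounded abs_wallisRatio_sq_le (t := t)
    (by rwa [abs_of_nonneg h0])).le_tsum 0 fun n _ => by positivity

theorem ellF_pos {t : ℝ} (h0 : 0 ≤ t) (h1 : t < 1) : 0 < ellF t :=
  one_pos.trans_le (one_le_ellF h0 h1)

theorem ellF_le_one_sub_log {t : ℝ} (h0 : 0 ≤ t) (h1 : t < 1) :
    ellF t ≤ 1 - Real.log (1 - t) := by
  have ht : |t| < 1 := by rwa [abs_of_nonneg h0]
  have hs := summable_mul_pow_of_bounded abs_wallisRatio_sq_le ht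
  have hlog := Real.hasSum_pow_div_log_of_abs_lt_one ht
  have hle : ∑' n, wallisRatio (n + 1) ^ 2 * t ^ (n + 1) ≤ -Real.log (1 - t) := by
    rw [← hlog.tsum_eq]
    refine ((summable_nat_add_iff 1).2 hs).tsum_le_tsum (fun n => ?_) hlog.summable
    have hn := mul_wallisRatio_sq_le_one (n + 1)
    push_cast at hn
    rw [div_eq_inv_mul]
    gcongr
    rwa [← one_div, le_div_iff₀' (by positivity)]
  rw [ellF, hs.tsum_eq_zero_add, wallisRatio_zero, one_pow, pow_zero, mul_one]
  linarith

theorem ellF_le_rpow {t : ℝ} (h0 : 0 ≤ t) (h1 : t < 1) :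
    ellF t ≤ 8 * (1 - t) ^ (-(1 / 8) : ℝ) := by
  have hpos : 0 < 1 - t := by linarith
  have hlog := Real.log_le_sub_one_of_pos (Real.rpow_pos_of_pos hpos (-(1 / 8)))
  rw [Real.log_rpow hpos] at hlog
  linarith [ellF_le_one_sub_log h0 h1]

/-! ### Shifted Legendre polynomials -/

section Legendre

open Polynomial

/-- The shifted Legendre polynomial `P_n(1 - 2X)`, with real coefficients and value `1` at `0`. -/
def realLegendre (n : ℕ) : ℝ[X] := (shiftedLegendre n).map (Int.castRingHom ℝ)

theorem coeff_realLegendre (n k : ℕ) :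
    (realLegendre n).coeff k = (-1) ^ k * n.choose k * (n + k).choose n := by
  simp [realLegendre, coeff_shiftedLegendre]

theorem degree_realLegendre (n : ℕ) : (realLegendre n).degree = n := by
  rw [realLegendre, degree_map_eq_of_injective (Int.cast_injective), degree_shiftedLegendre]

theorem realLegendre_zero : realLegendre 0 = 1 := by simp [realLegendre, shiftedLegendre]

theorem eval_one_sub_realLegendre (n : ℕ) (t : ℝ) :
    (realLegendre n).eval (1 - t) = (-1) ^ n * (realLegendre n).eval t := by
  simpa [realLegendre, eval_map, aeval_def] using shiftedLegendre_eval_symm n (1 - t)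

theorem succ_sq_mul_coeff_realLegendre_succ (n k : ℕ) :
    ((k : ℝ) + 1) ^ 2 * (realLegendre n).coeff (k + 1) =
      -((n - k) * (n + k + 1)) * (realLegendre n).coeff k := by
  have hlower : ((n.choose (k + 1) : ℝ)) * (k + 1) = n.choose k * (n - k) := by
    rcases le_or_gt k n with hk | hk
    · exact_mod_cast Nat.choose_succ_right_eq n k
    · simp [Nat.choose_eq_zero_of_lt hk, Nat.choose_eq_zero_of_lt (Nat.lt_succ_of_lt hk)]
  have hupper : (((n + k).choose n : ℝ)) * (n + k + 1) = (n + (k + 1)).choose n * (k + 1) := by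
    have h := Nat.choose_mul_succ_eq (n + k) n
    rw [add_assoc n k 1, Nat.add_sub_cancel_left] at h
    exact_mod_cast h
  rw [coeff_realLegendre, coeff_realLegendre, pow_succ]
  linear_combination (-(-1) ^ k * ((n + (k + 1)).choose n : ℝ) * (k + 1)) * hlower
    + (-1) ^ k * (n.choose k : ℝ) * (n - k) * hupper

theorem sub_mul_coeff_realLegendre_succ (n k : ℕ) :
    ((n : ℝ) + 1 - k) * (realLegendre (n + 1)).coeff k =
      (n + 1 + k) * (realLegendre n).coeff k := by
  have hlower : (n.choose k : ℝ) * (n + 1) = (n + 1).choose k * (n + 1 - k) := by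
    rcases le_or_gt k (n + 1) with hk | hk
    · exact_mod_cast Nat.choose_mul_succ_eq n k
    · simp [Nat.choose_eq_zero_of_lt hk, Nat.choose_eq_zero_of_lt (Nat.lt_of_succ_lt hk)]
  have hupper :
      ((n : ℝ) + 1 + k) * (n + k).choose n = (n + 1 + k).choose (n + 1) * (n + 1) := by
    have h := Nat.add_one_mul_choose_eq (n + k) n
    rw [add_right_comm n k 1] at h
    exact_mod_cast h
  refine mul_left_cancel₀ (Nat.cast_add_one_ne_zero n : (n : ℝ) + 1 ≠ 0) ?_
  rw [coeff_realLegendre, coeff_realLegendre]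
  linear_combination (-(-1) ^ k * ((n + 1 + k).choose (n + 1) : ℝ) * (n + 1)) * hlower
    - (-1) ^ k * (n.choose k : ℝ) * (n + 1) * hupper

section Coeff

variable (p : ℝ[X]) (k : ℕ)

theorem coeff_X_mul_one_sub_X_mul_derivative :
    (X * (1 - X) * derivative p).coeff (k + 1) = (k + 1) * p.coeff (k + 1) - k * p.coeff k := by
  rw [mul_assoc, coeff_X_mul, sub_mul, one_mul, coeff_sub, coeff_derivative]
  rcases k with _ | k
  · simp
  · rw [coeff_X_mul, coeff_derivative]
    push_cast
    ring

theorem coeff_succ_one_sub_two_mul_X_mul :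
    ((1 - 2 * X) * p).coeff (k + 1) = p.coeff (k + 1) - 2 * p.coeff k := by
  rw [sub_mul, one_mul, coeff_sub, mul_assoc, coeff_ofNat_mul, coeff_X_mul]

end Coeff

theorem derivative_X_mul_one_sub_X_mul_derivative_realLegendre (n : ℕ) :
    derivative (X * (1 - X) * derivative (realLegendre n)) =
      -C ((n : ℝ) * (n + 1)) * realLegendre n := by
  ext k
  rw [coeff_derivative, coeff_X_mul_one_sub_X_mul_derivative, ← C_neg, coeff_C_mul]
  linear_combination succ_sq_mul_coeff_realLegendre_succ n k

theorem X_mul_one_sub_X_mul_derivative_realLegendre_succ (n : ℕ) :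
    -2 * (X * (1 - X) * derivative (realLegendre (n + 1))) =
      C ((n : ℝ) + 1) * (realLegendre n - (1 - 2 * X) * realLegendre (n + 1)) := by
  ext k
  rw [neg_mul, coeff_neg, coeff_ofNat_mul, coeff_C_mul, coeff_sub]
  rcases k with _ | k
  · simp [coeff_realLegendre]
  rw [coeff_X_mul_one_sub_X_mul_derivative, coeff_succ_one_sub_two_mul_X_mul]
  have hn := succ_sq_mul_coeff_realLegendre_succ n k
  have hsucc := succ_sq_mul_coeff_realLegendre_succ (n + 1) k
  refine mul_left_cancel₀ (pow_ne_zero 2 (Nat.cast_add_one_ne_zero k : (k : ℝ) + 1 ≠ 0)) ?_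
  push_cast at hsucc
  linear_combination (n - 2 * k - 1 : ℝ) * hsucc - (n + 1 : ℝ) * hn
    + (n + 1 : ℝ) * (k - n) * sub_mul_coeff_realLegendre_succ n k

theorem X_mul_one_sub_X_mul_derivative_realLegendre (n : ℕ) :
    -2 * (X * (1 - X) * derivative (realLegendre n)) =
      C ((n : ℝ) + 1) * ((1 - 2 * X) * realLegendre n - realLegendre (n + 1)) := by
  ext k
  rw [neg_mul, coeff_neg, coeff_ofNat_mul, coeff_C_mul, coeff_sub]
  rcases k with _ | k
  · simp [coeff_realLegendre]
  rw [coeff_X_mul_one_sub_X_mul_derivative, coeff_succ_one_sub_two_mul_X_mul]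
  have hn := succ_sq_mul_coeff_realLegendre_succ n k
  have hsucc := succ_sq_mul_coeff_realLegendre_succ (n + 1) k
  refine mul_left_cancel₀ (pow_ne_zero 2 (Nat.cast_add_one_ne_zero k : (k : ℝ) + 1 ≠ 0)) ?_
  push_cast at hsucc
  linear_combination (-(n + 2 * k + 3) : ℝ) * hn + (n + 1 : ℝ) * hsucc
    - (n + 1 : ℝ) * (n + k + 2) * sub_mul_coeff_realLegendre_succ n k

theorem realLegendre_add_two (n : ℕ) :
    C ((n : ℝ) + 2) * realLegendre (n + 2) =
      C (2 * (n : ℝ) + 3) * ((1 - 2 * X) * realLegendre (n + 1)) -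
        C ((n : ℝ) + 1) * realLegendre n := by
  have hpred := X_mul_one_sub_X_mul_derivative_realLegendre_succ n
  have hsucc := X_mul_one_sub_X_mul_derivative_realLegendre (n + 1)
  simp only [Nat.cast_succ, C_add, C_mul, C_1, C_ofNat] at hpred hsucc ⊢
  linear_combination hsucc - hpred

theorem integral_eval_derivative (p : ℝ[X]) :
    ∫ t in (0 : ℝ)..1, (derivative p).eval t = p.eval 1 - p.eval 0 :=
  intervalIntegral.integral_eq_sub_of_hasDerivAt (fun t _ => p.hasDerivAt t)
    ((derivative p).continuous.intervalIntegrable _ _)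

theorem integral_realLegendre_mul_of_ne {m n : ℕ} (h : m ≠ n) :
    ∫ t in (0 : ℝ)..1, (realLegendre m * realLegendre n).eval t = 0 := by
  have hderiv : derivative (X * (1 - X) * derivative (realLegendre m) * realLegendre n
      - X * (1 - X) * derivative (realLegendre n) * realLegendre m) =
      C ((n : ℝ) * (n + 1) - m * (m + 1)) * (realLegendre m * realLegendre n) := by
    rw [derivative_sub, derivative_mul (g := realLegendre n), derivative_mul (g := realLegendre m),
      derivative_X_mul_one_sub_X_mul_derivative_realLegendre,
      derivative_X_mul_one_sub_X_mul_derivative_realLegendre, C_sub]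
    ring
  have hint := integral_eval_derivative (X * (1 - X) * derivative (realLegendre m) *
    realLegendre n - X * (1 - X) * derivative (realLegendre n) * realLegendre m)
  rw [hderiv] at hint
  simp only [eval_mul, eval_C, eval_sub, eval_X, eval_one, sub_self, mul_zero, zero_mul,
    sub_zero, mul_one, intervalIntegral.integral_const_mul] at hint
  simp only [eval_mul]
  refine (mul_eq_zero.1 hint).resolve_left fun heq => h ?_
  have hmul : ((m : ℝ) - n) * (n + m + 1) = 0 := by linear_combination -heq
  exact_mod_cast sub_eq_zero.1 ((mul_eq_zero.1 hmul).resolve_right (by positivity))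

theorem derivative_X_mul_one_sub_X_mul_realLegendre_mul (n : ℕ) :
    derivative (C (2 * (2 * (n : ℝ) + 3)) *
        (X * (1 - X) * (realLegendre n * realLegendre (n + 1)))) =
      C (2 * ((n : ℝ) + 2)) * (realLegendre (n + 2) * realLegendre n) -
        C ((n : ℝ) + 1) * (C (2 * (n : ℝ) + 1) * (realLegendre n * realLegendre n) -
          C (2 * (n : ℝ) + 3) * (realLegendre (n + 1) * realLegendre (n + 1))) := by
  have hn := X_mul_one_sub_X_mul_derivative_realLegendre n
  have hsucc := X_mul_one_sub_X_mul_derivative_realLegendre_succ n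
  have hrec := realLegendre_add_two n
  rw [derivative_C_mul]
  simp only [derivative_mul, derivative_sub, derivative_one, derivative_X,
    C_add, C_mul, C_ofNat, C_1] at *
  linear_combination (-(2 * C (n : ℝ) + 3)) * (realLegendre (n + 1) * hn + realLegendre n * hsucc)
    - 2 * realLegendre n * hrec

theorem integral_realLegendre_mul_self (n : ℕ) :
    ∫ t in (0 : ℝ)..1, (realLegendre n * realLegendre n).eval t = 1 / (2 * n + 1) := by
  induction n with
  | zero => simp [realLegendre_zero]
  | succ n ih =>
    have hint : ∀ p : ℝ[X], IntervalIntegrable (fun t => p.eval t) volume 0 1 :=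
      fun p => p.continuous.intervalIntegrable _ _
    have h := integral_eval_derivative (C (2 * (2 * (n : ℝ) + 3)) *
        (X * (1 - X) * (realLegendre n * realLegendre (n + 1))))
    rw [derivative_X_mul_one_sub_X_mul_realLegendre_mul] at h
    simp only [eval_sub, eval_C_mul] at h
    rw [intervalIntegral.integral_sub ((hint _).const_mul _)
        ((((hint _).const_mul _).sub ((hint _).const_mul _)).const_mul _),
      intervalIntegral.integral_const_mul, intervalIntegral.integral_const_mul,
      intervalIntegral.integral_sub ((hint _).const_mul _) ((hint _).const_mul _),
      intervalIntegral.integral_const_mul, intervalIntegral.integral_const_mul,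
      integral_realLegendre_mul_of_ne (by omega), ih] at h
    simp only [eval_mul, eval_X, eval_sub, eval_one, sub_self, mul_zero, zero_mul, zero_sub,
      neg_eq_zero, mul_eq_zero, sub_eq_zero, Nat.cast_add_one_ne_zero n, false_or] at h ⊢
    rw [mul_one_div_cancel (by positivity)] at h
    push_cast
    rw [eq_div_iff (by positivity)]
    linear_combination -h

end Legendre

section Parseval

open Polynomial

/-- The class in `L²` of the unit interval of a real polynomial. -/
def polynomialToLp : ℝ[X] →ₗ[ℝ] Lp ℝ 2 (volume : Measure unitInterval) :=
  (ContinuousMap.toLp 2 (volume : Measure unitInterval) ℝ).toLinearMap ∘ₗ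
    (toContinuousMapOnAlgHom unitInterval).toLinearMap

theorem coeFn_polynomialToLp (p : ℝ[X]) :
    polynomialToLp p =ᵐ[volume] fun x : unitInterval => p.eval (x : ℝ) :=
  ContinuousMap.coeFn_toLp (𝕜 := ℝ) volume (toContinuousMapOnAlgHom unitInterval p)

theorem denseRange_polynomialToLp : DenseRange polynomialToLp := by
  have hdense : DenseRange (toContinuousMapOnAlgHom unitInterval : ℝ[X] → C(unitInterval, ℝ)) := by
    rw [DenseRange, ← polynomialFunctions_coe, dense_iff_closure_eq,
      ← Subalgebra.topologicalClosure_coe, polynomialFunctions_closure_eq_top', Algebra.coe_top]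
  exact (ContinuousMap.toLp_denseRange ℝ volume ℝ (by simp)).comp hdense
    (ContinuousMap.toLp 2 volume ℝ).continuous

theorem integral_unitInterval (f : ℝ → ℝ) :
    ∫ x : unitInterval, f x = ∫ t in (0 : ℝ)..1, f t := by
  rw [intervalIntegral.integral_of_le zero_le_one, ← integral_Icc_eq_integral_Ioc]
  exact integral_subtype measurableSet_Icc f

theorem inner_polynomialToLp {f : ℝ → ℝ} {g : Lp ℝ 2 (volume : Measure unitInterval)}
    (hg : g =ᵐ[volume] fun x : unitInterval => f x) (p : ℝ[X]) :
    inner ℝ g (polynomialToLp p) = ∫ t in (0 : ℝ)..1, f t * p.eval t := by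
  rw [L2.inner_def, ← integral_unitInterval]
  refine integral_congr_ae ?_
  filter_upwards [hg, coeFn_polynomialToLp p] with x hgx hpx
  rw [hgx, hpx, RCLike.inner_apply', conj_trivial]

/-- The shifted Legendre polynomials scaled to have norm one in `L²` of the unit interval. -/
def normalizedLegendre : Polynomial.Sequence ℝ where
  elems' n := √(2 * n + 1) • realLegendre n
  degree_eq' n := by
    rw [smul_eq_C_mul, degree_C_mul (by positivity), degree_realLegendre]

theorem normalizedLegendre_apply (n : ℕ) :
    normalizedLegendre n = √(2 * n + 1) • realLegendre n := rfl

theorem orthonormal_normalizedLegendre :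
    Orthonormal ℝ fun n => polynomialToLp (normalizedLegendre n) := by
  rw [orthonormal_iff_ite]
  intro m n
  have hinner : inner ℝ (polynomialToLp (normalizedLegendre m))
      (polynomialToLp (normalizedLegendre n)) = √(2 * m + 1) * √(2 * n + 1) *
        ∫ t in (0 : ℝ)..1, (realLegendre m * realLegendre n).eval t := by
    rw [inner_polynomialToLp (f := fun t => (normalizedLegendre m).eval t)
      (coeFn_polynomialToLp _), ← intervalIntegral.integral_const_mul]
    refine intervalIntegral.integral_congr fun t _ => ?_
    simp only [normalizedLegendre_apply, eval_smul, smul_eq_mul, eval_mul]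
    ring
  rw [hinner]
  split_ifs with hmn
  · subst hmn
    rw [integral_realLegendre_mul_self, Real.mul_self_sqrt (by positivity),
      mul_one_div_cancel (by positivity)]
  · rw [integral_realLegendre_mul_of_ne hmn, mul_zero]

theorem span_normalizedLegendre_dense :
    ⊤ ≤ (Submodule.span ℝ (Set.range fun n =>
      polynomialToLp (normalizedLegendre n))).topologicalClosure := by
  have hspan : Submodule.span ℝ (Set.range normalizedLegendre) = ⊤ :=
    normalizedLegendre.span fun n =>
      (leadingCoeff_ne_zero.2 (normalizedLegendre.ne_zero n)).isUnit
  rw [Set.range_comp' polynomialToLp, ← Submodule.map_span, hspan, Submodule.map_top, top_le_iff,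
    ← Submodule.dense_iff_topologicalClosure_eq_top, LinearMap.coe_range]
  exact denseRange_polynomialToLp

theorem hasSum_sq_integral_mul_realLegendre {f : ℝ → ℝ}
    (hf : MemLp f 2 (volume.restrict (Icc 0 1))) :
    HasSum (fun n : ℕ => (2 * n + 1) * (∫ t in (0 : ℝ)..1, f t * (realLegendre n).eval t) ^ 2)
      (∫ t in (0 : ℝ)..1, f t ^ 2) := by
  have hf' : MemLp (fun x : unitInterval => f x) 2 volume :=
    hf.comp_measurePreserving (measurePreserving_subtype_coe measurableSet_Icc)
  have hsum := (HilbertBasis.mk orthonormal_normalizedLegendre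
    span_normalizedLegendre_dense).hasSum_inner_mul_inner (hf'.toLp _) (hf'.toLp _)
  have hnorm : inner ℝ (hf'.toLp _) (hf'.toLp _) = ∫ t in (0 : ℝ)..1, f t ^ 2 := by
    rw [L2.inner_def, ← integral_unitInterval]
    refine integral_congr_ae ?_
    filter_upwards [hf'.coeFn_toLp] with x hx
    rw [hx, RCLike.inner_apply', conj_trivial, sq]
  have hcoeff : ∀ n : ℕ, inner ℝ (hf'.toLp _) (polynomialToLp (normalizedLegendre n)) =
      √(2 * n + 1) * ∫ t in (0 : ℝ)..1, f t * (realLegendre n).eval t := fun n => by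
    rw [inner_polynomialToLp hf'.coeFn_toLp, ← intervalIntegral.integral_const_mul]
    simp only [normalizedLegendre_apply, eval_smul, smul_eq_mul, mul_left_comm]
  rw [hnorm] at hsum
  refine hsum.congr_fun fun n => ?_
  rw [HilbertBasis.coe_mk, real_inner_comm (hf'.toLp _), hcoeff, mul_mul_mul_comm,
    Real.mul_self_sqrt (by positivity), sq]

end Parseval

/-! ### The product `F(t) F(1 - t)` and its Legendre coefficients -/

theorem abs_lt_one_of_mem_Ioo {t : ℝ} (ht : t ∈ Ioo (0 : ℝ) 1) : |t| < 1 :=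
  abs_lt.2 ⟨by linarith [ht.1], ht.2⟩

theorem one_sub_mem_Ioo {t : ℝ} (ht : t ∈ Ioo (0 : ℝ) 1) : 1 - t ∈ Ioo (0 : ℝ) 1 :=
  ⟨by linarith [ht.2], by linarith [ht.1]⟩

theorem hasDerivAt_mul_one_sub (t : ℝ) : HasDerivAt (fun t : ℝ => t * (1 - t)) (1 - 2 * t) t :=
  ((hasDerivAt_id t).mul ((hasDerivAt_id t).const_sub 1)).congr_deriv
    (by simp only [id_eq]; ring)

theorem tendsto_one_sub_nhdsGT_zero : Tendsto (fun t : ℝ => 1 - t) (𝓝[>] 0) (𝓝[<] 1) := by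
  simpa using (continuous_sub_left (1 : ℝ)).continuousWithinAt.tendsto_nhdsWithin
    (s := Ioi 0) (t := Iio (1 - 0)) (x := 0) fun _ ht => sub_lt_sub_left ht 1

theorem tendsto_one_sub_nhdsLT_one : Tendsto (fun t : ℝ => 1 - t) (𝓝[<] 1) (𝓝[>] 0) := by
  simpa using (continuous_sub_left (1 : ℝ)).continuousWithinAt.tendsto_nhdsWithin
    (s := Iio 1) (t := Ioi (1 - 1)) (x := 1) fun _ ht => sub_lt_sub_left ht 1

theorem tendsto_id_nhdsGT_zero : Tendsto (fun t : ℝ => t) (𝓝[>] 0) (𝓝 0) := nhdsWithin_le_nhds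

theorem tendsto_one_sub_nhdsGT_zero_one : Tendsto (fun t : ℝ => 1 - t) (𝓝[>] 0) (𝓝 1) :=
  tendsto_one_sub_nhdsGT_zero.mono_right nhdsWithin_le_nhds

theorem hasDerivAt_ellF_one_sub {t : ℝ} (ht : t ∈ Ioo (0 : ℝ) 1) :
    HasDerivAt (fun t => ellF (1 - t)) (-(ellG (1 - t) / t)) t :=
  ((hasDerivAt_ellF (abs_lt_one_of_mem_Ioo (one_sub_mem_Ioo ht))).comp_const_sub 1 t).congr_deriv
    (by rw [sub_sub_cancel])

theorem hasDerivAt_one_sub_mul_ellG {t : ℝ} (ht : t ∈ Ioo (0 : ℝ) 1) :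
    HasDerivAt (fun t => (1 - t) * ellG (1 - t)) (-(ellF (1 - t) / 4)) t :=
  (hasDerivAt_mul_ellG (abs_lt_one_of_mem_Ioo (one_sub_mem_Ioo ht))).comp_const_sub 1 t

theorem continuousOn_ellF : ContinuousOn ellF (Ico 0 1) := fun t ht =>
  (hasDerivAt_ellF (by rw [abs_of_nonneg ht.1]; exact ht.2)).continuousAt.continuousWithinAt

theorem continuousOn_ellF_one_sub : ContinuousOn (fun t => ellF (1 - t)) (Ioo 0 1) := fun _ ht =>
  (hasDerivAt_ellF_one_sub ht).continuousAt.continuousWithinAt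

theorem ellF_one_sub_pos {t : ℝ} (ht : t ∈ Ioo (0 : ℝ) 1) : 0 < ellF (1 - t) :=
  ellF_pos (one_sub_mem_Ioo ht).1.le (one_sub_mem_Ioo ht).2

theorem ellF_one_sub_le_rpow {t : ℝ} (ht : t ∈ Ioo (0 : ℝ) 1) :
    ellF (1 - t) ≤ 8 * t ^ (-(1 / 8) : ℝ) := by
  simpa only [sub_sub_cancel] using
    ellF_le_rpow (one_sub_mem_Ioo ht).1.le (one_sub_mem_Ioo ht).2

theorem tendsto_ellF_zero : Tendsto ellF (𝓝[>] 0) (𝓝 1) := by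
  rw [← ellF_zero]
  exact (hasDerivAt_ellF (t := 0) (by simp)).continuousAt.tendsto.mono_left nhdsWithin_le_nhds

theorem tendsto_ellG_zero : Tendsto ellG (𝓝[>] 0) (𝓝 (ellG 0)) :=
  (continuousOn_ellG 0 (by simp)).mono_of_mem_nhdsWithin (Icc_mem_nhdsGT one_pos)

theorem tendsto_ellG_one_sub : Tendsto (fun t => ellG (1 - t)) (𝓝[>] 0) (𝓝 (1 / π)) := by
  rw [← ellG_one]
  exact Tendsto.comp ((continuousOn_ellG 1 (by simp)).mono_of_mem_nhdsWithin
    (Icc_mem_nhdsLT one_pos)) tendsto_one_sub_nhdsGT_zero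

theorem tendsto_mul_ellF_one_sub : Tendsto (fun t => t * ellF (1 - t)) (𝓝[>] 0) (𝓝 0) := by
  have hpow : Tendsto (fun t : ℝ => 8 * t ^ (7 / 8 : ℝ)) (𝓝[>] 0) (𝓝 0) := by
    have h := ((Real.continuous_rpow_const (q := 7 / 8) (by norm_num)).const_mul 8).tendsto 0
    rw [Real.zero_rpow (by norm_num), mul_zero] at h
    exact h.mono_left nhdsWithin_le_nhds
  refine squeeze_zero' ?_ ?_ hpow
  · filter_upwards [Ioo_mem_nhdsGT (zero_lt_one' ℝ)] with t ht
    exact mul_nonneg ht.1.le (ellF_one_sub_pos ht).le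
  · filter_upwards [Ioo_mem_nhdsGT (zero_lt_one' ℝ)] with t ht
    calc t * ellF (1 - t) ≤ t * (8 * t ^ (-(1 / 8) : ℝ)) :=
          mul_le_mul_of_nonneg_left (ellF_one_sub_le_rpow ht) ht.1.le
      _ = 8 * (t ^ (1 : ℝ) * t ^ (-(1 / 8) : ℝ)) := by rw [Real.rpow_one]; ring
      _ = 8 * t ^ (7 / 8 : ℝ) := by rw [← Real.rpow_add ht.1]; norm_num

theorem intervalIntegrable_ellF_one_sub :
    IntervalIntegrable (fun t => ellF (1 - t)) volume 0 1 := by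
  rw [intervalIntegrable_iff_integrableOn_Ioo_of_le zero_le_one]
  have hpow : IntegrableOn (fun t : ℝ => 8 * t ^ (-(1 / 8) : ℝ)) (Ioo 0 1) := by
    rw [← intervalIntegrable_iff_integrableOn_Ioo_of_le zero_le_one]
    exact (intervalIntegral.intervalIntegrable_rpow' (by norm_num)).const_mul 8
  refine hpow.mono' (continuousOn_ellF_one_sub.aestronglyMeasurable measurableSet_Ioo) ?_
  filter_upwards [ae_restrict_mem measurableSet_Ioo] with t ht
  rw [Real.norm_of_nonneg (ellF_one_sub_pos ht).le]
  exact ellF_one_sub_le_rpow ht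

theorem intervalIntegrable_pow_mul_ellF_one_sub (k : ℕ) :
    IntervalIntegrable (fun t => t ^ k * ellF (1 - t)) volume 0 1 :=
  intervalIntegrable_ellF_one_sub.continuousOn_mul (continuous_pow k).continuousOn

/-- The product `F(t) F(1 - t)`, whose Legendre expansion produces the hypergeometric series. -/
def ellW (t : ℝ) : ℝ := ellF t * ellF (1 - t)

/-- The expression `t (1 - t) W'(t)`, written without derivatives. -/
def ellD (t : ℝ) : ℝ := t * ellG t * ellF (1 - t) - ellF t * ((1 - t) * ellG (1 - t))

/-- The expression `t (1 - t) D'(t) = (t (1 - t) d/dt)² W(t)`, written without derivatives. -/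
def ellB (t : ℝ) : ℝ :=
  t * (1 - t) * ellW t / 2 - 2 * (t * ellG t) * ((1 - t) * ellG (1 - t))

theorem ellW_one_sub (t : ℝ) : ellW (1 - t) = ellW t := by
  rw [ellW, ellW, sub_sub_cancel, mul_comm]

theorem ellB_one_sub (t : ℝ) : ellB (1 - t) = ellB t := by
  rw [ellB, ellB, ellW_one_sub, sub_sub_cancel]
  ring

theorem ellD_one_sub (t : ℝ) : ellD (1 - t) = -ellD t := by
  rw [ellD, ellD, sub_sub_cancel]
  ring

theorem continuousOn_ellW : ContinuousOn ellW (Ioo 0 1) :=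
  (continuousOn_ellF.mono Ioo_subset_Ico_self).mul continuousOn_ellF_one_sub

theorem ellW_sq_le {t : ℝ} (ht : t ∈ Ioo (0 : ℝ) 1) :
    ellW t ^ 2 ≤ 2048 * (t ^ (-(1 / 2) : ℝ) + (1 - t) ^ (-(1 / 2) : ℝ)) := by
  have hpow : ∀ {x : ℝ}, 0 ≤ x → x ^ (-(1 / 2) : ℝ) = (x ^ (-(1 / 8) : ℝ)) ^ 4 := fun hx => by
    rw [← Real.rpow_natCast, ← Real.rpow_mul hx]
    norm_num
  rw [hpow ht.1.le, hpow (one_sub_mem_Ioo ht).1.le]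
  set a := t ^ (-(1 / 8) : ℝ)
  set b := (1 - t) ^ (-(1 / 8) : ℝ)
  have hpos := ellF_pos ht.1.le ht.2
  have hpos' := ellF_one_sub_pos ht
  have hle : ellF t ≤ 8 * b := ellF_le_rpow ht.1.le ht.2
  have hle' : ellF (1 - t) ≤ 8 * a := ellF_one_sub_le_rpow ht
  calc (ellF t * ellF (1 - t)) ^ 2 ≤ ((8 * b) * (8 * a)) ^ 2 := by
        gcongr
        exact hpos.le.trans hle
    _ ≤ 2048 * (a ^ 4 + b ^ 4) := by nlinarith [sq_nonneg (a ^ 2 - b ^ 2)]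

theorem memLp_ellW : MemLp ellW 2 (volume.restrict (Icc 0 1)) := by
  rw [← restrict_Ioo_eq_restrict_Icc]
  have hmeas := continuousOn_ellW.aestronglyMeasurable (μ := volume) measurableSet_Ioo
  rw [memLp_two_iff_integrable_sq hmeas]
  have hbound : IntegrableOn (fun t : ℝ => 2048 * (t ^ (-(1 / 2) : ℝ) + (1 - t) ^ (-(1 / 2) : ℝ)))
      (Ioo 0 1) := by
    rw [← intervalIntegrable_iff_integrableOn_Ioo_of_le zero_le_one]
    have h : IntervalIntegrable (fun t : ℝ => t ^ (-(1 / 2) : ℝ)) volume 0 1 :=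
      intervalIntegral.intervalIntegrable_rpow' (by norm_num)
    have h' := (h.comp_sub_left 1).symm
    rw [sub_zero, sub_self] at h'
    exact (h.add h').const_mul _
  refine hbound.mono' (hmeas.pow 2) ?_
  filter_upwards [ae_restrict_mem measurableSet_Ioo] with t ht
  rw [Real.norm_of_nonneg (sq_nonneg _)]
  exact ellW_sq_le ht

theorem intervalIntegrable_ellW_mul (p : Polynomial ℝ) :
    IntervalIntegrable (fun t => ellW t * p.eval t) volume 0 1 := by
  refine IntervalIntegrable.mul_continuousOn ?_ p.continuous.continuousOn
  rw [intervalIntegrable_iff_integrableOn_Icc_of_le zero_le_one]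
  exact memLp_ellW.integrable (by norm_num)

theorem hasDerivAt_ellW {t : ℝ} (ht : t ∈ Ioo (0 : ℝ) 1) :
    HasDerivAt ellW (ellD t / (t * (1 - t))) t := by
  refine ((hasDerivAt_ellF (abs_lt_one_of_mem_Ioo ht)).mul
    (hasDerivAt_ellF_one_sub ht)).congr_deriv ?_
  have h0 : t ≠ 0 := ht.1.ne'
  have h1 : 1 - t ≠ 0 := (one_sub_mem_Ioo ht).1.ne'
  rw [ellD]
  field

theorem hasDerivAt_ellD {t : ℝ} (ht : t ∈ Ioo (0 : ℝ) 1) :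
    HasDerivAt ellD (ellB t / (t * (1 - t))) t := by
  refine (((hasDerivAt_mul_ellG (abs_lt_one_of_mem_Ioo ht)).mul (hasDerivAt_ellF_one_sub ht)).sub
    ((hasDerivAt_ellF (abs_lt_one_of_mem_Ioo ht)).mul
      (hasDerivAt_one_sub_mul_ellG ht))).congr_deriv ?_
  have h0 : t ≠ 0 := ht.1.ne'
  have h1 : 1 - t ≠ 0 := (one_sub_mem_Ioo ht).1.ne'
  rw [ellB, ellW]
  field

theorem hasDerivAt_ellB {t : ℝ} (ht : t ∈ Ioo (0 : ℝ) 1) :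
    HasDerivAt ellB (ellD t + (1 - 2 * t) / 2 * ellW t) t := by
  refine ((((hasDerivAt_mul_one_sub t).mul (hasDerivAt_ellW ht)).div_const 2).sub
    (((hasDerivAt_mul_ellG (abs_lt_one_of_mem_Ioo ht)).const_mul 2).mul
      (hasDerivAt_one_sub_mul_ellG ht))).congr_deriv ?_
  have h0 : t ≠ 0 := ht.1.ne'
  have h1 : 1 - t ≠ 0 := (one_sub_mem_Ioo ht).1.ne'
  rw [ellD, ellW]
  field

theorem tendsto_mul_ellW_zero : Tendsto (fun t => t * (1 - t) * ellW t) (𝓝[>] 0) (𝓝 0) := by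
  simpa using ((tendsto_one_sub_nhdsGT_zero_one.mul tendsto_ellF_zero).mul
    tendsto_mul_ellF_one_sub).congr fun t => by rw [ellW, mul_mul_mul_comm, mul_comm (1 - t)]

theorem tendsto_ellB_zero : Tendsto ellB (𝓝[>] 0) (𝓝 0) := by
  simpa using ((tendsto_mul_ellW_zero.div_const 2).sub
    (((tendsto_id_nhdsGT_zero.mul tendsto_ellG_zero).const_mul 2).mul
      (tendsto_one_sub_nhdsGT_zero_one.mul tendsto_ellG_one_sub))).congr fun t => by rw [ellB]

theorem tendsto_ellD_zero : Tendsto ellD (𝓝[>] 0) (𝓝 (-(1 / π))) := by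
  simpa using ((tendsto_ellG_zero.mul tendsto_mul_ellF_one_sub).sub (tendsto_ellF_zero.mul
    (tendsto_one_sub_nhdsGT_zero_one.mul tendsto_ellG_one_sub))).congr fun t => by
      rw [ellD, mul_left_comm, ← mul_assoc]

/-- The boundary term when `F(t) F(1 - t)` is integrated against a polynomial `p` satisfying the
Legendre equation `(t (1 - t) p')' = -μ p`. -/
def legendreBoundary (p : Polynomial ℝ) (μ t : ℝ) : ℝ :=
  p.eval t * ellB t - (Polynomial.X * (1 - Polynomial.X) * Polynomial.derivative p).eval t * ellD t
    - (μ + 1) * (p.eval t * (t * (1 - t) * ellW t))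

section LegendreCoefficients

open Polynomial

theorem hasDerivAt_legendreBoundary {p : ℝ[X]} {μ t : ℝ}
    (hp : derivative (X * (1 - X) * derivative p) = -C μ * p) (ht : t ∈ Ioo (0 : ℝ) 1) :
    HasDerivAt (legendreBoundary p μ)
      (-(ellW t * (C (2 * μ + 1) * ((1 - 2 * X) * p) +
        C (2 * (μ + 1)) * (X * (1 - X) * derivative p)).eval t) / 2) t := by
  have hsp := (X * (1 - X) * derivative p).hasDerivAt t
  rw [hp] at hsp
  refine ((((p.hasDerivAt t).mul (hasDerivAt_ellB ht)).sub (hsp.mul (hasDerivAt_ellD ht))).sub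
    (((p.hasDerivAt t).mul ((hasDerivAt_mul_one_sub t).mul (hasDerivAt_ellW ht))).const_mul
      (μ + 1))).congr_deriv ?_
  have h0 : t ≠ 0 := ht.1.ne'
  have h1 : 1 - t ≠ 0 := (one_sub_mem_Ioo ht).1.ne'
  simp only [eval_mul, eval_add, eval_sub, eval_neg, eval_C, eval_X, eval_one, eval_ofNat,
    Pi.mul_apply]
  field

theorem tendsto_legendreBoundary_zero (p : ℝ[X]) (μ : ℝ) :
    Tendsto (legendreBoundary p μ) (𝓝[>] 0) (𝓝 0) := by
  have heval : ∀ q : ℝ[X], Tendsto (fun t => q.eval t) (𝓝[>] 0) (𝓝 (q.eval 0)) := fun q =>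
    (q.continuous.tendsto 0).mono_left nhdsWithin_le_nhds
  have h := (((heval p).mul tendsto_ellB_zero).sub
    ((heval (X * (1 - X) * derivative p)).mul tendsto_ellD_zero)).sub
      (((heval p).mul tendsto_mul_ellW_zero).const_mul (μ + 1))
  simp only [eval_mul, eval_X, zero_mul, mul_zero, sub_zero] at h
  exact h.congr fun t => by rw [legendreBoundary, eval_mul, eval_mul, eval_X]

theorem legendreBoundary_comp_one_sub (p : ℝ[X]) (μ t : ℝ) :
    legendreBoundary (p.comp (1 - X)) μ (1 - t) = legendreBoundary p μ t := by
  simp only [legendreBoundary, ellB_one_sub, ellD_one_sub, ellW_one_sub, derivative_comp,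
    derivative_sub, derivative_one, derivative_X, eval_comp, eval_mul, eval_sub, eval_one, eval_X,
    eval_zero, sub_sub_cancel]
  ring

theorem tendsto_legendreBoundary_one (p : ℝ[X]) (μ : ℝ) :
    Tendsto (legendreBoundary p μ) (𝓝[<] 1) (𝓝 0) :=
  ((tendsto_legendreBoundary_zero (p.comp (1 - X)) μ).comp tendsto_one_sub_nhdsLT_one).congr
    (legendreBoundary_comp_one_sub p μ)

theorem integral_ellW_mul_eq_zero {p : ℝ[X]} {μ : ℝ}
    (hp : derivative (X * (1 - X) * derivative p) = -C μ * p) :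
    ∫ t in (0 : ℝ)..1, ellW t * (C (2 * μ + 1) * ((1 - 2 * X) * p) +
      C (2 * (μ + 1)) * (X * (1 - X) * derivative p)).eval t = 0 := by
  have h := intervalIntegral.integral_eq_sub_of_hasDerivAt_of_tendsto zero_lt_one
    (fun _ ht => hasDerivAt_legendreBoundary hp ht)
    ((intervalIntegrable_ellW_mul _).neg.div_const 2)
    (tendsto_legendreBoundary_zero p μ) (tendsto_legendreBoundary_one p μ)
  simpa only [intervalIntegral.integral_div, intervalIntegral.integral_neg, sub_zero,
    div_eq_zero_iff, neg_eq_zero, OfNat.ofNat_ne_zero, or_false] using h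

theorem realLegendre_add_two_fourth_power (n : ℕ) :
    C ((n + 2 : ℝ) ^ 4) * realLegendre (n + 2) - C ((n + 1 : ℝ) ^ 4) * realLegendre n =
      C (2 * n + 3 : ℝ) *
        (C (2 * ((n + 1 : ℕ) * ((n + 1 : ℕ) + 1)) + 1 : ℝ) *
            ((1 - 2 * X) * realLegendre (n + 1)) +
          C (2 * ((n + 1 : ℕ) * ((n + 1 : ℕ) + 1) + 1) : ℝ) *
            (X * (1 - X) * derivative (realLegendre (n + 1)))) := by
  have hrec := realLegendre_add_two n
  have hderiv := X_mul_one_sub_X_mul_derivative_realLegendre_succ n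
  simp only [Nat.cast_succ, C_add, C_mul, C_pow, C_1, C_ofNat] at hrec hderiv ⊢
  linear_combination (C (n : ℝ) + 2) ^ 3 * hrec +
    (2 * C (n : ℝ) + 3) * ((C (n : ℝ) + 1) * (C (n : ℝ) + 2) + 1) * hderiv

theorem integral_ellW_mul_realLegendre_add_two (n : ℕ) :
    ((n : ℝ) + 2) ^ 4 * (∫ t in (0 : ℝ)..1, ellW t * (realLegendre (n + 2)).eval t) =
      ((n : ℝ) + 1) ^ 4 * ∫ t in (0 : ℝ)..1, ellW t * (realLegendre n).eval t := by
  have h : ∫ t in (0 : ℝ)..1, ellW t * (C ((n + 2 : ℝ) ^ 4) * realLegendre (n + 2) -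
      C ((n + 1 : ℝ) ^ 4) * realLegendre n).eval t = 0 := by
    simp only [realLegendre_add_two_fourth_power n, eval_C_mul (p := _ + _),
      mul_left_comm (ellW _)]
    rw [intervalIntegral.integral_const_mul, integral_ellW_mul_eq_zero
      (derivative_X_mul_one_sub_X_mul_derivative_realLegendre (n + 1)), mul_zero]
  simp only [eval_sub, eval_C_mul, mul_sub, mul_left_comm (ellW _)] at h
  rwa [intervalIntegral.integral_sub ((intervalIntegrable_ellW_mul _).const_mul _)
    ((intervalIntegrable_ellW_mul _).const_mul _), intervalIntegral.integral_const_mul,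
    intervalIntegral.integral_const_mul, sub_eq_zero] at h

theorem integral_ellW_mul_realLegendre_odd (n : ℕ) :
    ∫ t in (0 : ℝ)..1, ellW t * (realLegendre (2 * n + 1)).eval t = 0 := by
  have h := intervalIntegral.integral_comp_sub_left
    (fun t => ellW t * (realLegendre (2 * n + 1)).eval t) (a := 0) (b := 1) 1
  simp only [ellW_one_sub, eval_one_sub_realLegendre, (odd_two_mul_add_one n).neg_one_pow,
    neg_one_mul, mul_neg, intervalIntegral.integral_neg, sub_zero, sub_self] at h
  exact self_eq_neg.1 h.symm

theorem integral_ellW_mul_realLegendre_even (n : ℕ) :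
    ∫ t in (0 : ℝ)..1, ellW t * (realLegendre (2 * n)).eval t =
      wallisRatio n ^ 4 * ∫ t in (0 : ℝ)..1, ellW t := by
  induction n with
  | zero => simp [realLegendre_zero]
  | succ n ih =>
    have hrec := integral_ellW_mul_realLegendre_add_two (2 * n)
    rw [ih] at hrec
    have hn : ((2 * n : ℕ) : ℝ) + 2 ≠ 0 := by positivity
    refine mul_left_cancel₀ (pow_ne_zero 4 hn) ?_
    rw [Nat.mul_succ, hrec, wallisRatio_succ]
    push_cast
    field

end LegendreCoefficients

theorem integral_pow_mul_ellF_one_sub_succ (n : ℕ) :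
    ((n : ℝ) + 3 / 2) ^ 2 * (∫ t in (0 : ℝ)..1, t ^ (n + 1) * ellF (1 - t)) =
      ((n : ℝ) + 1) ^ 2 * ∫ t in (0 : ℝ)..1, t ^ n * ellF (1 - t) := by
  let H : ℝ → ℝ := fun t => -(t ^ (n + 1) * ((1 - t) * ellG (1 - t))) -
    (n + 1) * (t ^ (n + 1) * (1 - t) * ellF (1 - t))
  have hderiv : ∀ t ∈ Ioo (0 : ℝ) 1, HasDerivAt H ((n + 3 / 2) ^ 2 * (t ^ (n + 1) * ellF (1 - t)) -
      (n + 1) ^ 2 * (t ^ n * ellF (1 - t))) t := by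
    intro t ht
    refine ((((hasDerivAt_pow (n + 1) t).mul (hasDerivAt_one_sub_mul_ellG ht)).neg).sub
      ((((hasDerivAt_pow (n + 1) t).mul ((hasDerivAt_id t).const_sub 1)).mul
        (hasDerivAt_ellF_one_sub ht)).const_mul ((n : ℝ) + 1))).congr_deriv ?_
    have h0 : t ≠ 0 := ht.1.ne'
    simp only [Nat.add_sub_cancel, pow_succ, id, Pi.mul_apply, Nat.cast_succ]
    field
  have hzero : Tendsto H (𝓝[>] 0) (𝓝 0) := by
    have h := ((tendsto_id_nhdsGT_zero.pow (n + 1)).mul (tendsto_one_sub_nhdsGT_zero_one.mul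
      tendsto_ellG_one_sub)).neg.sub ((((tendsto_id_nhdsGT_zero.pow n).mul
        tendsto_one_sub_nhdsGT_zero_one).mul tendsto_mul_ellF_one_sub).const_mul ((n : ℝ) + 1))
    simp only [ne_eq, n.succ_ne_zero, not_false_eq_true, zero_pow, zero_mul, mul_zero, neg_zero,
      sub_zero] at h
    exact h.congr fun t => by ring
  have hone : Tendsto H (𝓝[<] 1) (𝓝 0) := by
    have h := (((tendsto_one_sub_nhdsGT_zero_one.pow (n + 1)).mul
      (tendsto_id_nhdsGT_zero.mul tendsto_ellG_zero)).neg.sub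
      ((((tendsto_one_sub_nhdsGT_zero_one.pow (n + 1)).mul tendsto_id_nhdsGT_zero).mul
        tendsto_ellF_zero).const_mul ((n : ℝ) + 1))).comp tendsto_one_sub_nhdsLT_one
    simp only [zero_mul, mul_zero, neg_zero, sub_zero] at h
    exact h.congr fun t => by simp only [Function.comp, sub_sub_cancel, H]
  have hint := intervalIntegrable_pow_mul_ellF_one_sub
  have h := intervalIntegral.integral_eq_sub_of_hasDerivAt_of_tendsto zero_lt_one hderiv
    (((hint _).const_mul _).sub ((hint _).const_mul _)) hzero hone
  rwa [intervalIntegral.integral_sub ((hint _).const_mul _) ((hint _).const_mul _),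
    intervalIntegral.integral_const_mul, intervalIntegral.integral_const_mul, sub_zero,
    sub_eq_zero] at h

theorem integral_ellF_one_sub : ∫ t in (0 : ℝ)..1, ellF (1 - t) = 4 / π := by
  have hderiv : ∀ t ∈ Ioo (0 : ℝ) 1, HasDerivAt (fun t => -4 * ((1 - t) * ellG (1 - t)))
      (ellF (1 - t)) t := fun t ht =>
    ((hasDerivAt_one_sub_mul_ellG ht).const_mul (-4)).congr_deriv (by ring)
  have hzero := (tendsto_one_sub_nhdsGT_zero_one.mul tendsto_ellG_one_sub).const_mul (-4)
  have hone := ((tendsto_id_nhdsGT_zero.mul tendsto_ellG_zero).const_mul (-4)).comp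
    tendsto_one_sub_nhdsLT_one
  rw [intervalIntegral.integral_eq_sub_of_hasDerivAt_of_tendsto zero_lt_one hderiv
    intervalIntegrable_ellF_one_sub hzero hone]
  ring

theorem wallisRatio_sq_mul_integral_pow_mul_ellF_one_sub (n : ℕ) :
    wallisRatio n ^ 2 * (∫ t in (0 : ℝ)..1, t ^ n * ellF (1 - t)) =
      4 / π * (1 / (2 * n + 1) ^ 2) := by
  induction n with
  | zero =>
    simp only [wallisRatio_zero, pow_zero, one_mul, integral_ellF_one_sub, Nat.cast_zero]
    ring
  | succ n ih =>
    have hn : (n : ℝ) + 3 / 2 ≠ 0 := by positivity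
    refine mul_left_cancel₀ (pow_ne_zero 2 hn) ?_
    calc ((n : ℝ) + 3 / 2) ^ 2 * (wallisRatio (n + 1) ^ 2 *
          ∫ t in (0 : ℝ)..1, t ^ (n + 1) * ellF (1 - t))
        = (((n : ℝ) + 1) * wallisRatio (n + 1)) ^ 2 * ∫ t in (0 : ℝ)..1, t ^ n * ellF (1 - t) := by
          rw [mul_left_comm, integral_pow_mul_ellF_one_sub_succ]
          ring
      _ = ((n : ℝ) + 1 / 2) ^ 2 * (4 / π * (1 / (2 * n + 1) ^ 2)) := by
          rw [succ_mul_wallisRatio_succ, ← ih]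
          ring
      _ = ((n : ℝ) + 3 / 2) ^ 2 * (4 / π * (1 / (2 * (n + 1 : ℕ) + 1) ^ 2)) := by
          push_cast
          field

theorem hasSum_one_div_odd_sq :
    HasSum (fun n : ℕ => 1 / (2 * (n : ℝ) + 1) ^ 2) (π ^ 2 / 8) := by
  have hodd : Summable fun n : ℕ => 1 / ((2 * n + 1 : ℕ) : ℝ) ^ 2 :=
    hasSum_zeta_two.summable.comp_injective fun a b (hab : 2 * a + 1 = 2 * b + 1) => by omega
  have heven : HasSum (fun n : ℕ => 1 / ((2 * n : ℕ) : ℝ) ^ 2) (1 / 4 * (π ^ 2 / 6)) :=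
    (hasSum_zeta_two.mul_left (1 / 4)).congr_fun fun n => by
      rw [Nat.cast_mul, mul_pow, Nat.cast_ofNat]
      ring
  have h := (HasSum.even_add_odd (f := fun n : ℕ => 1 / (n : ℝ) ^ 2) heven
    hodd.hasSum).unique hasSum_zeta_two
  have hval : ∑' n : ℕ, 1 / ((2 * n + 1 : ℕ) : ℝ) ^ 2 = π ^ 2 / 8 := by linarith
  exact (hval ▸ hodd.hasSum).congr_fun fun n => by push_cast; rfl

theorem integral_ellW : ∫ t in (0 : ℝ)..1, ellW t = π / 2 := by
  let f : ℕ → ℝ → ℝ := fun k t => wallisRatio k ^ 2 * (t ^ k * ellF (1 - t))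
  have hint : ∀ k, IntegrableOn (f k) (Ioo 0 1) := fun k =>
    (intervalIntegrable_iff_integrableOn_Ioo_of_le zero_le_one).1
      ((intervalIntegrable_pow_mul_ellF_one_sub k).const_mul _)
  have hval : ∀ k, ∫ t in Ioo (0 : ℝ) 1, f k t = 4 / π * (1 / (2 * k + 1) ^ 2) := fun k => by
    rw [← integral_Ioc_eq_integral_Ioo, ← intervalIntegral.integral_of_le zero_le_one,
      intervalIntegral.integral_const_mul, wallisRatio_sq_mul_integral_pow_mul_ellF_one_sub]
  have hnorm : ∀ k, ∫ t in Ioo (0 : ℝ) 1, ‖f k t‖ = 4 / π * (1 / (2 * k + 1) ^ 2) := fun k => by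
    rw [← hval k]
    refine setIntegral_congr_fun measurableSet_Ioo fun t ht => Real.norm_of_nonneg ?_
    exact mul_nonneg (sq_nonneg _) (mul_nonneg (pow_nonneg ht.1.le k) (ellF_one_sub_pos ht).le)
  have hsum := hasSum_one_div_odd_sq.mul_left (4 / π)
  calc ∫ t in (0 : ℝ)..1, ellW t = ∫ t in Ioo (0 : ℝ) 1, ∑' k, f k t := by
        rw [intervalIntegral.integral_of_le zero_le_one, integral_Ioc_eq_integral_Ioo]
        simp only [ellW, ellF, ← tsum_mul_right, mul_assoc, f]
    _ = ∑' k, ∫ t in Ioo (0 : ℝ) 1, f k t :=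
        (integral_tsum_of_summable_integral_norm hint
          (hsum.summable.congr fun k => (hnorm k).symm)).symm
    _ = 4 / π * (π ^ 2 / 8) := by simp only [hval, hsum.tsum_eq]
    _ = π / 2 := by field

theorem hasSum_wallisRatio_pow_eight :
    HasSum (fun n : ℕ => wallisRatio n ^ 8 * (1 + 4 * n))
      (4 / π ^ 2 * ∫ t in (0 : ℝ)..1, ellW t ^ 2) := by
  have hparseval := hasSum_sq_integral_mul_realLegendre memLp_ellW
  have hinj : Function.Injective fun n : ℕ => 2 * n := mul_right_injective₀ two_ne_zero
  have hodd : ∀ n ∉ range fun n : ℕ => 2 * n,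
      (2 * (n : ℝ) + 1) * (∫ t in (0 : ℝ)..1, ellW t * (realLegendre n).eval t) ^ 2 = 0 := by
    intro n hn
    obtain ⟨k, rfl⟩ : Odd n := Nat.not_even_iff_odd.1 fun ⟨k, hk⟩ => hn ⟨k, by grind⟩
    rw [integral_ellW_mul_realLegendre_odd, zero_pow two_ne_zero, mul_zero]
  refine (((hinj.hasSum_iff hodd).2 hparseval).mul_left (4 / π ^ 2)).congr_fun fun n => ?_
  rw [Function.comp_apply, integral_ellW_mul_realLegendre_even, integral_ellW]
  push_cast
  field

/-! ### The even periods of the twelfth power of the eta function -/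

/-- The cusp form `η(τ)¹²`, of weight six with the sign character at `τ ↦ τ + 1`. -/
def etaTwelve (τ : ℂ) : ℂ := ModularForm.eta τ ^ 12

theorem etaTwelve_add_one (τ : ℂ) : etaTwelve (τ + 1) = -etaTwelve τ := by
  have hq : ∀ n, ModularForm.eta_q n (τ + 1) = ModularForm.eta_q n τ := fun n => by
    rw [ModularForm.eta_q_eq_pow, ModularForm.eta_q_eq_pow, mul_add, mul_one, Complex.exp_add,
      Complex.exp_two_pi_mul_I, mul_one]
  have hparam : Function.Periodic.qParam 24 (τ + 1) ^ 12 =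
      -Function.Periodic.qParam 24 τ ^ 12 := by
    simp only [Function.Periodic.qParam, ← Complex.exp_nat_mul]
    rw [← neg_one_mul, ← Complex.exp_pi_mul_I, ← Complex.exp_add]
    congr 1
    push_cast
    ring
  simp only [etaTwelve, ModularForm.eta, hq, mul_pow, hparam, neg_mul]

theorem etaTwelve_neg_one_div {τ : ℂ} (hτ : 0 < τ.im) :
    etaTwelve (-1 / τ) = -τ ^ 6 * etaTwelve τ := by
  have hsqrt : ∀ z : ℂ, Complex.sqrt z ^ 12 = z ^ 6 := fun z => by
    rw [show 12 = 2 * 6 by rfl, pow_mul, Complex.sqrt, ← Complex.cpow_nat_mul]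
    norm_num
  have hI : Complex.I ^ 6 = -1 := by
    rw [show 6 = 2 * 3 by rfl, pow_mul, Complex.I_sq]
    norm_num
  have h := ModularForm.eta_comp_eq_csqrt_I_inv (x := τ) hτ
  simp only [Function.comp, Pi.smul_apply, Pi.mul_apply, smul_eq_mul] at h
  rw [etaTwelve, h, mul_pow, mul_pow, inv_pow, hsqrt, hsqrt, hI, etaTwelve]
  ring

theorem differentiableAt_etaTwelve {τ : ℂ} (hτ : 0 < τ.im) : DifferentiableAt ℂ etaTwelve τ :=
  (ModularForm.differentiableAt_eta_of_mem_upperHalfPlaneSet hτ).pow 12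

theorem exists_norm_etaTwelve_le :
    ∃ A : ℝ, ∀ τ : ℂ, A ≤ τ.im → ‖etaTwelve τ‖ ≤ 2 * Real.exp (-π * τ.im) := by
  obtain ⟨A, hA⟩ := (UpperHalfPlane.atImInfty_mem _).1
    (ModularForm.tendsto_atImInfty_tprod_one_sub_eta_q_pow.norm.eventually_lt_const
      (show ‖(1 : ℂ)‖ < 4 by norm_num))
  refine ⟨max A 1, fun τ hτ => ?_⟩
  have hpos : 0 < τ.im := one_pos.trans_le ((le_max_right _ _).trans hτ)
  have hexp : ‖Function.Periodic.qParam 1 τ‖ = Real.exp (-π * τ.im) ^ 2 := by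
    rw [Function.Periodic.norm_qParam, ← Real.exp_nat_mul]
    congr 1
    push_cast
    ring
  refine le_of_sq_le_sq ?_ (by positivity)
  calc ‖etaTwelve τ‖ ^ 2 = ‖ModularForm.discriminant ⟨τ, hpos⟩‖ := by
        rw [← norm_pow, etaTwelve, ← pow_mul, ModularForm.discriminant]
    _ ≤ Real.exp (-π * τ.im) ^ 2 * 4 := by
        rw [ModularForm.discriminant_eq_q_prod, norm_mul, ← hexp]
        exact mul_le_mul_of_nonneg_left
          (hA ⟨τ, hpos⟩ ((le_max_left _ _).trans hτ)).le (norm_nonneg _)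
    _ = (2 * Real.exp (-π * τ.im)) ^ 2 := by ring

theorem continuousOn_etaTwelve_I_mul :
    ContinuousOn (fun y : ℝ => etaTwelve (Complex.I * y)) (Ioi 0) := fun y hy =>
  ((differentiableAt_etaTwelve (by simpa using hy)).continuousAt.comp
    (f := fun y : ℝ => Complex.I * (y : ℂ)) (by fun_prop)).continuousWithinAt

theorem I_mul_inv_eq_neg_one_div (y : ℝ) : Complex.I * (y⁻¹ : ℝ) = -1 / (Complex.I * y) := by
  rw [Complex.ofReal_inv, neg_div, ← div_div, one_div, Complex.inv_I, neg_div, neg_neg,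
    div_eq_mul_inv]

theorem etaTwelve_I_mul_inv {y : ℝ} (hy : 0 < y) :
    etaTwelve (Complex.I * (y⁻¹ : ℝ)) = (y : ℂ) ^ 6 * etaTwelve (Complex.I * y) := by
  rw [I_mul_inv_eq_neg_one_div, etaTwelve_neg_one_div (by simpa using hy), mul_pow,
    show 6 = 2 * 3 by rfl, pow_mul, Complex.I_sq]
  ring

theorem isBigO_etaTwelve_I_mul_rpow (r : ℝ) :
    (fun y : ℝ => etaTwelve (Complex.I * y)) =O[atTop] fun y : ℝ => y ^ r := by
  obtain ⟨A, hA⟩ := exists_norm_etaTwelve_le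
  refine IsBigO.trans (.of_bound 2 ?_) (isLittleO_exp_neg_mul_rpow_atTop Real.pi_pos r).isBigO
  filter_upwards [eventually_ge_atTop A] with y hy
  simpa using hA (Complex.I * y) (by simpa using hy)

/-- The function `y ↦ η(iy)¹²` with its self-dual functional equation of weight six. -/
def etaTwelveFEPair : WeakFEPair ℂ where
  f y := etaTwelve (Complex.I * y)
  g y := etaTwelve (Complex.I * y)
  k := 6
  ε := 1
  f₀ := 0
  g₀ := 0
  hf_int := continuousOn_etaTwelve_I_mul.locallyIntegrableOn measurableSet_Ioi
  hg_int := continuousOn_etaTwelve_I_mul.locallyIntegrableOn measurableSet_Ioi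
  hk := by norm_num
  hε := one_ne_zero
  h_feq y hy := by
    rw [one_div, etaTwelve_I_mul_inv hy]
    norm_cast
    simp
  hf_top r := by simpa using isBigO_etaTwelve_I_mul_rpow r
  hg_top r := by simpa using isBigO_etaTwelve_I_mul_rpow r

theorem isStrongFEPair_etaTwelveFEPair : IsStrongFEPair etaTwelveFEPair := ⟨rfl, rfl⟩

/-- The completed `L`-function of `η¹²`, i.e. the Mellin transform of `y ↦ η(iy)¹²`. -/
def etaMellin (s : ℂ) : ℂ := mellin (fun y : ℝ => etaTwelve (Complex.I * y)) s

theorem mellinConvergent_etaTwelve (s : ℂ) :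
    MellinConvergent (fun y : ℝ => etaTwelve (Complex.I * y)) s :=
  (isStrongFEPair_etaTwelveFEPair.hasMellin s).1

theorem etaMellin_six_sub (s : ℂ) : etaMellin (6 - s) = etaMellin s := by
  have h := etaTwelveFEPair.functional_equation s
  rw [isStrongFEPair_etaTwelveFEPair.Λ_eq, isStrongFEPair_etaTwelveFEPair.symm_Λ_eq] at h
  simpa [etaTwelveFEPair, etaMellin] using h

theorem integrableOn_etaTwelve_mul_pow (n : ℕ) :
    IntegrableOn (fun y : ℝ => etaTwelve (Complex.I * y) * (y : ℂ) ^ n) (Ioi 0) := by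
  refine (mellinConvergent_etaTwelve (n + 1)).congr_fun (fun y _ => ?_) measurableSet_Ioi
  simp [mul_comm]

theorem integral_etaTwelve_mul_pow (n : ℕ) :
    ∫ y : ℝ in Ioi 0, etaTwelve (Complex.I * y) * (y : ℂ) ^ n = etaMellin (n + 1) := by
  simp [etaMellin, mellin, mul_comm]

theorem integrableOn_sum_mul_etaTwelve_mul_pow {n : ℕ} (c : Fin n → ℂ) :
    IntegrableOn (fun y : ℝ => ∑ j, c j * (etaTwelve (Complex.I * y) * (y : ℂ) ^ (j : ℕ)))
      (Ioi 0) :=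
  integrable_finsetSum _ fun j _ => (integrableOn_etaTwelve_mul_pow j).const_mul (c j)

theorem integral_sum_mul_etaTwelve_mul_pow {n : ℕ} (c : Fin n → ℂ) :
    ∫ y : ℝ in Ioi 0, ∑ j, c j * (etaTwelve (Complex.I * y) * (y : ℂ) ^ (j : ℕ)) =
      ∑ j, c j * etaMellin (j + 1) := by
  rw [integral_finsetSum _ fun (j : Fin n) _ =>
    (integrableOn_etaTwelve_mul_pow j).const_mul (c j)]
  simp only [integral_const_mul, integral_etaTwelve_mul_pow]

/-- The form `η(τ)¹² (τ² - τ + 1)²`. Since `τ² - τ + 1` vanishes at the fixed point of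
`τ ↦ 1 / (1 - τ)`, its differential is invariant under this map of order three. -/
def etaForm (τ : ℂ) : ℂ := etaTwelve τ * (τ ^ 2 - τ + 1) ^ 2

theorem differentiableAt_etaForm {τ : ℂ} (hτ : 0 < τ.im) : DifferentiableAt ℂ etaForm τ :=
  (differentiableAt_etaTwelve hτ).mul (by fun_prop)

theorem one_sub_ne_zero_of_im_pos {τ : ℂ} (hτ : 0 < τ.im) : 1 - τ ≠ 0 := by
  rw [sub_ne_zero]
  rintro rfl
  simp at hτ

theorem etaForm_one_div_one_sub {τ : ℂ} (hτ : 0 < τ.im) :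
    etaForm (1 / (1 - τ)) = (1 - τ) ^ 2 * etaForm τ := by
  have h0 := one_sub_ne_zero_of_im_pos hτ
  have h := etaTwelve_neg_one_div (τ := τ - 1) (by simpa using hτ)
  have hneg : etaTwelve (τ - 1) = -etaTwelve τ := by
    rw [eq_neg_iff_add_eq_zero, add_comm, ← eq_neg_iff_add_eq_zero, ← etaTwelve_add_one,
      sub_add_cancel]
  rw [hneg, ← neg_sub 1 τ, neg_div_neg_eq] at h
  rw [etaForm, etaForm, h]
  field

theorem etaForm_neg_one_div {τ : ℂ} (hτ : 0 < τ.im) :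
    etaForm (-1 / τ) = τ ^ 2 * etaForm (1 + τ) := by
  have h0 : τ ≠ 0 := by rintro rfl; simp at hτ
  rw [etaForm, etaForm, etaTwelve_neg_one_div hτ, add_comm 1 τ, etaTwelve_add_one]
  field

/-- A Euclidean disc which is a hyperbolic disc around `exp (π i / 3)`, hence stable under
`τ ↦ 1 / (1 - τ)`; it contains the segment from `i` to `1 + i`. -/
def stableDisc : Set ℂ := Metric.ball (1 / 2 + 3 / 2 * Complex.I : ℂ) (√(3 / 2))

theorem mem_stableDisc_iff (τ : ℂ) :
    τ ∈ stableDisc ↔ Complex.normSq τ - τ.re + 1 < 3 * τ.im := by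
  rw [stableDisc, mem_ball_iff_norm, Real.lt_sqrt (norm_nonneg _), ← Complex.normSq_eq_norm_sq,
    Complex.normSq_apply, Complex.normSq_apply]
  simp only [one_div, Complex.sub_re, Complex.add_re, Complex.inv_re, Complex.re_ofNat,
    Complex.normSq_ofNat, Complex.mul_re, Complex.div_ofNat_re, Complex.I_re, Complex.div_ofNat_im,
    Complex.I_im, Complex.sub_im, Complex.add_im, Complex.inv_im, Complex.im_ofNat, Complex.mul_im]
  constructor <;> intro h <;> linarith

theorem im_pos_of_mem_stableDisc {τ : ℂ} (h : τ ∈ stableDisc) : 0 < τ.im := by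
  rw [mem_stableDisc_iff, Complex.normSq_apply] at h
  nlinarith [sq_nonneg (τ.re - 1 / 2), sq_nonneg τ.im]

theorem one_div_one_sub_mem_stableDisc {τ : ℂ} (h : τ ∈ stableDisc) :
    1 / (1 - τ) ∈ stableDisc := by
  have hpos := Complex.normSq_pos.2 (one_sub_ne_zero_of_im_pos (im_pos_of_mem_stableDisc h))
  have hnorm : Complex.normSq (1 - τ) = 1 - 2 * τ.re + Complex.normSq τ := by
    simp only [Complex.normSq_apply, Complex.sub_re, Complex.sub_im, Complex.one_re,
      Complex.one_im]
    ring
  rw [mem_stableDisc_iff] at h ⊢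
  rw [one_div, Complex.normSq_inv, Complex.inv_re, Complex.inv_im,
    ← mul_lt_mul_iff_of_pos_right hpos]
  simp only [Complex.sub_re, Complex.sub_im, Complex.one_re, Complex.one_im]
  field_simp
  linarith

theorem ofReal_add_I_mem_stableDisc {x : ℝ} (hx : x ∈ Icc (0 : ℝ) 1) :
    (x : ℂ) + Complex.I ∈ stableDisc := by
  rw [mem_stableDisc_iff, Complex.normSq_apply]
  simp only [Complex.add_re, Complex.add_im, Complex.ofReal_re, Complex.ofReal_im, Complex.I_re,
    Complex.I_im]
  nlinarith [hx.1, hx.2]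

theorem hasDerivAt_one_div_one_sub {τ : ℂ} (hτ : 1 - τ ≠ 0) :
    HasDerivAt (fun τ : ℂ => 1 / (1 - τ)) (1 / (1 - τ) ^ 2) τ := by
  simpa only [one_div, id, neg_neg] using! ((hasDerivAt_id τ).const_sub 1).inv hτ

/- The increment of a primitive along `τ ↦ 1 / (1 - τ)` is constant on the disc, and three times
this constant vanishes because the map has order three. -/
theorem exists_invariant_primitive_etaForm :
    ∃ Φ : ℂ → ℂ, ∀ τ ∈ stableDisc, HasDerivAt Φ (etaForm τ) τ ∧ Φ (1 / (1 - τ)) = Φ τ := by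
  have hdiff : DifferentiableOn ℂ etaForm stableDisc := fun τ hτ =>
    (differentiableAt_etaForm (im_pos_of_mem_stableDisc hτ)).differentiableWithinAt
  obtain ⟨Φ, hΦ⟩ := hdiff.isExactOn_ball
  refine ⟨Φ, fun τ hτ => ⟨hΦ τ hτ, ?_⟩⟩
  have hderiv : ∀ z ∈ stableDisc, HasDerivAt (fun z => Φ (1 / (1 - z)) - Φ z) 0 z := by
    intro z hz
    have h0 := one_sub_ne_zero_of_im_pos (im_pos_of_mem_stableDisc hz)
    refine ((HasDerivAt.comp z (hΦ _ (one_div_one_sub_mem_stableDisc hz))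
      (hasDerivAt_one_div_one_sub h0)).sub (hΦ z hz)).congr_deriv ?_
    rw [etaForm_one_div_one_sub (im_pos_of_mem_stableDisc hz)]
    field
  have hconst : ∀ z ∈ stableDisc, Φ (1 / (1 - z)) - Φ z = Φ (1 / (1 - τ)) - Φ τ := fun z hz =>
    Metric.isOpen_ball.is_const_of_deriv_eq_zero (convex_ball _ _).isPreconnected
      (fun w hw => (hderiv w hw).differentiableAt.differentiableWithinAt)
      (fun w hw => (hderiv w hw).deriv) hz hτ
  have hτ' := one_div_one_sub_mem_stableDisc hτ
  have horder : 1 / (1 - 1 / (1 - 1 / (1 - τ))) = τ := by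
    have h0 := one_sub_ne_zero_of_im_pos (im_pos_of_mem_stableDisc hτ)
    have h1 := one_sub_ne_zero_of_im_pos (im_pos_of_mem_stableDisc hτ')
    have hτ0 : τ ≠ 0 := by
      rintro rfl
      simpa using im_pos_of_mem_stableDisc hτ
    have : 1 - τ - 1 ≠ 0 := by simpa using hτ0
    field_simp
    ring
  have hsecond := hconst _ hτ'
  have hthird := hconst _ (one_div_one_sub_mem_stableDisc hτ')
  rw [horder] at hthird
  linear_combination (-1 / 3 : ℂ) * hsecond - (1 / 3 : ℂ) * hthird

theorem integral_etaForm_add_I : ∫ x in (0 : ℝ)..1, etaForm (x + Complex.I) = 0 := by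
  obtain ⟨Φ, hΦ⟩ := exists_invariant_primitive_etaForm
  have hderiv : ∀ x ∈ uIcc (0 : ℝ) 1,
      HasDerivAt (fun x : ℝ => Φ (x + Complex.I)) (etaForm (x + Complex.I)) x := fun x hx => by
    rw [uIcc_of_le zero_le_one] at hx
    simpa using! (hΦ _ (ofReal_add_I_mem_stableDisc hx)).1.comp x
      ((Complex.ofRealCLM.hasDerivAt (x := x)).add_const Complex.I)
  have hcont : ContinuousOn (fun x : ℝ => etaForm (x + Complex.I)) (uIcc 0 1) := fun x _ =>
    ((differentiableAt_etaForm (by simp)).continuousAt.comp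
      (f := fun x : ℝ => (x : ℂ) + Complex.I) (by fun_prop)).continuousWithinAt
  have hI := ofReal_add_I_mem_stableDisc (x := 1) (by simp)
  have hfixed := (hΦ _ hI).2
  have hval : 1 / (1 - ((1 : ℝ) + Complex.I)) = Complex.I := by simp
  rw [intervalIntegral.integral_eq_sub_of_hasDerivAt hderiv hcont.intervalIntegrable, ← hfixed,
    hval, Complex.ofReal_zero, zero_add, sub_self]

theorem etaForm_I_mul (y : ℝ) : etaForm (Complex.I * y) =
    ∑ j : Fin 5, (![1, -2 * Complex.I, -3, 2 * Complex.I, 1] : Fin 5 → ℂ) j *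
      (etaTwelve (Complex.I * y) * (y : ℂ) ^ (j : ℕ)) := by
  simp only [etaForm, Fin.sum_univ_five, Matrix.cons_val, Fin.coe_ofNat_eq_mod, Nat.reduceMod]
  linear_combination etaTwelve (Complex.I * y) *
    (y ^ 4 * (Complex.I ^ 2 - 1) - 2 * y ^ 3 * Complex.I + 3 * y ^ 2) * Complex.I_sq

theorem etaForm_one_add_I_mul (y : ℝ) : etaForm (1 + Complex.I * y) =
    ∑ j : Fin 5, (![-1, -2 * Complex.I, 3, 2 * Complex.I, -1] : Fin 5 → ℂ) j *
      (etaTwelve (Complex.I * y) * (y : ℂ) ^ (j : ℕ)) := by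
  simp only [etaForm, add_comm 1 (Complex.I * y), etaTwelve_add_one, Fin.sum_univ_five,
    Matrix.cons_val, Fin.coe_ofNat_eq_mod, Nat.reduceMod]
  linear_combination -etaTwelve (Complex.I * y) *
    (y ^ 4 * (Complex.I ^ 2 - 1) + 2 * y ^ 3 * Complex.I + 3 * y ^ 2) * Complex.I_sq

theorem integrableOn_etaForm_I_mul :
    IntegrableOn (fun y : ℝ => etaForm (Complex.I * y)) (Ioi 0) := by
  simp only [etaForm_I_mul]
  exact integrableOn_sum_mul_etaTwelve_mul_pow _

theorem integrableOn_etaForm_one_add_I_mul :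
    IntegrableOn (fun y : ℝ => etaForm (1 + Complex.I * y)) (Ioi 0) := by
  simp only [etaForm_one_add_I_mul]
  exact integrableOn_sum_mul_etaTwelve_mul_pow _

theorem norm_etaForm_le {τ : ℂ} {r : ℝ} (hr : 1 ≤ r) (hτ : ‖τ‖ ≤ 2 * r) :
    ‖etaForm τ‖ ≤ ‖etaTwelve τ‖ * (16 * r ^ 2) ^ 2 := by
  have hquad : ‖τ ^ 2 - τ + 1‖ ≤ 16 * r ^ 2 := by
    calc ‖τ ^ 2 - τ + 1‖ ≤ ‖τ ^ 2‖ + ‖τ‖ + ‖(1 : ℂ)‖ :=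
          (norm_add_le _ _).trans (by gcongr; exact norm_sub_le _ _)
      _ ≤ (2 * r) ^ 2 + 2 * r + 1 := by rw [norm_pow, norm_one]; gcongr
      _ ≤ 16 * r ^ 2 := by nlinarith
  rw [etaForm, norm_mul, norm_pow]
  gcongr

theorem tendsto_integral_etaForm_horizontal :
    Tendsto (fun Y : ℝ => ∫ x in (0 : ℝ)..1, etaForm (x + Y * Complex.I)) atTop (𝓝 0) := by
  obtain ⟨A, hA⟩ := exists_norm_etaTwelve_le
  have hlim : Tendsto (fun Y : ℝ => 512 * (Y ^ 4 * Real.exp (-π * Y))) atTop (𝓝 0) := by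
    simpa using
      (tendsto_rpow_mul_exp_neg_mul_atTop_nhds_zero 4 π Real.pi_pos).const_mul 512
  refine squeeze_zero_norm' ?_ hlim
  filter_upwards [eventually_ge_atTop A, eventually_ge_atTop 1] with Y hY hY1
  have hbound : ∀ x ∈ uIoc (0 : ℝ) 1, ‖etaForm (x + Y * Complex.I)‖ ≤
      512 * (Y ^ 4 * Real.exp (-π * Y)) := by
    intro x hx
    rw [uIoc_of_le zero_le_one] at hx
    have him : ((x : ℂ) + Y * Complex.I).im = Y := by simp
    have heta := hA (x + Y * Complex.I) (him.symm ▸ hY)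
    have hnorm : ‖(x : ℂ) + Y * Complex.I‖ ≤ 2 * Y := by
      refine (norm_add_le _ _).trans ?_
      simp only [Complex.norm_mul, Complex.norm_real, Complex.norm_I, mul_one, Real.norm_eq_abs]
      rw [abs_of_pos hx.1, abs_of_pos (one_pos.trans_le hY1)]
      linarith [hx.2]
    rw [him] at heta
    calc ‖etaForm (x + Y * Complex.I)‖
        ≤ ‖etaTwelve (x + Y * Complex.I)‖ * (16 * Y ^ 2) ^ 2 := norm_etaForm_le hY1 hnorm
      _ ≤ 2 * Real.exp (-π * Y) * (16 * Y ^ 2) ^ 2 := by gcongr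
      _ = 512 * (Y ^ 4 * Real.exp (-π * Y)) := by ring
  simpa using intervalIntegral.norm_integral_le_of_norm_le_const hbound

theorem integral_etaForm_add_mul_I {Y : ℝ} (hY : 1 ≤ Y) :
    ∫ x in (0 : ℝ)..1, etaForm (x + Y * Complex.I) =
      Complex.I * (∫ y in (1 : ℝ)..Y, etaForm (1 + Complex.I * y)) -
        Complex.I * ∫ y in (1 : ℝ)..Y, etaForm (Complex.I * y) := by
  have hdiff : DifferentiableOn ℂ etaForm (uIcc 0 1 ×ℂ uIcc 1 Y) := fun τ hτ => by
    have him := hτ.2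
    rw [mem_preimage, uIcc_of_le hY] at him
    exact (differentiableAt_etaForm (one_pos.trans_le him.1)).differentiableWithinAt
  have h := Complex.integral_boundary_rect_eq_zero_of_differentiableOn etaForm Complex.I
    (1 + Y * Complex.I) (by simpa using hdiff)
  simp only [Complex.I_re, Complex.I_im, Complex.add_re, Complex.add_im, Complex.one_re,
    Complex.one_im, Complex.mul_re, Complex.mul_im, Complex.ofReal_re, Complex.ofReal_im,
    mul_zero, mul_one, sub_zero, add_zero, zero_add, Complex.ofReal_one, Complex.ofReal_zero,
    one_mul, smul_eq_mul, integral_etaForm_add_I] at h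
  simp only [mul_comm Complex.I (Complex.ofReal _)]
  linear_combination -h

theorem integral_Ioi_one_etaForm :
    ∫ y : ℝ in Ioi 1, etaForm (Complex.I * y) =
      ∫ y : ℝ in Ioi 1, etaForm (1 + Complex.I * y) := by
  have hsub : Ioi (1 : ℝ) ⊆ Ioi 0 := Ioi_subset_Ioi zero_le_one
  have hright := intervalIntegral_tendsto_integral_Ioi 1
    (integrableOn_etaForm_one_add_I_mul.mono_set hsub) tendsto_id
  have hleft := intervalIntegral_tendsto_integral_Ioi 1
    (integrableOn_etaForm_I_mul.mono_set hsub) tendsto_id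
  have hlim := tendsto_nhds_unique
    (((hright.const_mul Complex.I).sub (hleft.const_mul Complex.I)).congr'
      ((eventually_ge_atTop 1).mono fun _ hY => (integral_etaForm_add_mul_I hY).symm))
    tendsto_integral_etaForm_horizontal
  rw [← mul_sub] at hlim
  exact (sub_eq_zero.1 ((mul_eq_zero.1 hlim).resolve_left Complex.I_ne_zero)).symm

theorem integral_Ioo_etaForm :
    ∫ y : ℝ in Ioo 0 1, etaForm (Complex.I * y) =
      -∫ y : ℝ in Ioi 1, etaForm (1 + Complex.I * y) := by
  have himg : (fun y : ℝ => y⁻¹) '' Ioi 1 = Ioo 0 1 := by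
    rw [image_inv_eq_inv, Set.inv_Ioi₀ one_pos, inv_one]
  have h := integral_image_eq_integral_abs_deriv_smul (s := Ioi (1 : ℝ)) measurableSet_Ioi
    (f := fun y : ℝ => y⁻¹) (f' := fun y => -(y ^ 2)⁻¹)
    (fun y hy => (hasDerivAt_inv (zero_lt_one.trans hy).ne').hasDerivWithinAt)
    inv_injective.injOn (fun y : ℝ => etaForm (Complex.I * y))
  rw [himg] at h
  rw [h, ← integral_neg]
  refine setIntegral_congr_fun measurableSet_Ioi fun y hy => ?_
  have hy : 0 < y := zero_lt_one.trans hy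
  have hy' : (y : ℂ) ≠ 0 := by exact_mod_cast hy.ne'
  rw [I_mul_inv_eq_neg_one_div, etaForm_neg_one_div (by simpa using hy), abs_neg,
    abs_of_pos (by positivity), Complex.real_smul, mul_pow, Complex.I_sq]
  push_cast
  field

theorem integral_etaForm_I_mul : ∫ y : ℝ in Ioi 0, etaForm (Complex.I * y) = 0 := by
  rw [← Ioc_union_Ioi_eq_Ioi (zero_le_one (α := ℝ)), setIntegral_union
    (Ioc_disjoint_Ioi le_rfl) measurableSet_Ioi
    (integrableOn_etaForm_I_mul.mono_set Ioc_subset_Ioi_self)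
    (integrableOn_etaForm_I_mul.mono_set (Ioi_subset_Ioi zero_le_one)),
    integral_Ioc_eq_integral_Ioo, integral_Ioo_etaForm, integral_Ioi_one_etaForm,
    neg_add_cancel]

theorem two_mul_etaMellin_five : 2 * etaMellin 5 = 3 * etaMellin 3 := by
  have h := integral_etaForm_I_mul
  simp only [etaForm_I_mul, integral_sum_mul_etaTwelve_mul_pow] at h
  have hone := etaMellin_six_sub 5
  have htwo := etaMellin_six_sub 4
  simp only [Fin.sum_univ_five, Matrix.cons_val, Fin.coe_ofNat_eq_mod, Nat.reduceMod] at h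
  norm_num at h hone htwo
  rw [hone, htwo] at h
  linear_combination h

/-! ### Theta constants -/

/-- The theta constant `θ₂`; the constant `θ₃` is `jacobiTheta`. -/
def thetaTwo (τ : ℂ) : ℂ := Complex.exp (π * Complex.I * τ / 4) * jacobiTheta₂ (τ / 2) τ

/-- The theta constant `θ₄`. -/
def thetaFour (τ : ℂ) : ℂ := jacobiTheta₂ (1 / 2) τ

theorem differentiableAt_thetaTwo {τ : ℂ} (hτ : 0 < τ.im) : DifferentiableAt ℂ thetaTwo τ :=
  DifferentiableAt.mul (by fun_prop) ((hasFDerivAt_jacobiTheta₂ (τ / 2) hτ).differentiableAt.comp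
    (f := fun τ : ℂ => (τ / 2, τ)) τ (by fun_prop))

theorem differentiableAt_thetaFour {τ : ℂ} (hτ : 0 < τ.im) : DifferentiableAt ℂ thetaFour τ :=
  differentiableAt_jacobiTheta₂_snd (1 / 2) hτ

theorem cexp_pi_mul_I_mul_sq_add_self (n : ℤ) :
    Complex.exp (π * Complex.I * (n ^ 2 + n)) = 1 := by
  obtain ⟨k, hk⟩ := Int.even_mul_succ_self n
  have hk : (n : ℂ) ^ 2 + n = k + k := by
    exact_mod_cast (by rw [← hk]; ring : n ^ 2 + n = k + k)
  rw [hk, show (π : ℂ) * Complex.I * (k + k) = k * (2 * π * Complex.I) by ring,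
    Complex.exp_int_mul_two_pi_mul_I]

theorem thetaTwo_add_one (τ : ℂ) :
    thetaTwo (τ + 1) = Complex.exp (π * Complex.I / 4) * thetaTwo τ := by
  have h : jacobiTheta₂ ((τ + 1) / 2) (τ + 1) = jacobiTheta₂ (τ / 2) τ := by
    refine tsum_congr fun n => ?_
    rw [jacobiTheta₂_term, jacobiTheta₂_term, show 2 * π * Complex.I * n * ((τ + 1) / 2) +
      π * Complex.I * n ^ 2 * (τ + 1) = 2 * π * Complex.I * n * (τ / 2) +
      π * Complex.I * n ^ 2 * τ + π * Complex.I * (n ^ 2 + n) by ring, Complex.exp_add,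
      cexp_pi_mul_I_mul_sq_add_self, mul_one]
  rw [thetaTwo, thetaTwo, h, ← mul_assoc, ← Complex.exp_add]
  congr 2
  ring

theorem jacobiTheta_add_one (τ : ℂ) : jacobiTheta (τ + 1) = thetaFour τ := by
  rw [jacobiTheta_eq_jacobiTheta₂]
  refine tsum_congr fun n => ?_
  have h := cexp_pi_mul_I_mul_sq_add_self (-n)
  push_cast at h
  rw [jacobiTheta₂_term, jacobiTheta₂_term, show 2 * π * Complex.I * n * 0 +
    π * Complex.I * n ^ 2 * (τ + 1) = 2 * π * Complex.I * n * (1 / 2) +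
    π * Complex.I * n ^ 2 * τ + π * Complex.I * ((-n) ^ 2 + -n) by ring, Complex.exp_add, h,
    mul_one]

theorem thetaFour_add_one (τ : ℂ) : thetaFour (τ + 1) = jacobiTheta τ := by
  rw [← jacobiTheta_add_one, add_assoc, one_add_one_eq_two, add_comm, jacobiTheta_two_add]

theorem cpow_half_sq (z : ℂ) : (z ^ (1 / 2 : ℂ)) ^ 2 = z := by
  rw [← Complex.cpow_nat_mul]
  norm_num

theorem jacobiTheta_neg_one_div {τ : ℂ} (hτ : 0 < τ.im) :
    jacobiTheta (-1 / τ) ^ 2 = -Complex.I * τ * jacobiTheta τ ^ 2 := by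
  have h := jacobiTheta_S_smul ⟨τ, hτ⟩
  rw [modular_S_smul] at h
  rw [neg_div, one_div, ← inv_neg, ← cpow_half_sq (-Complex.I * τ), ← mul_pow]
  exact congrArg (· ^ 2) h

theorem thetaFour_neg_one_div {τ : ℂ} (hτ : τ ≠ 0) :
    thetaFour (-1 / τ) ^ 2 = -Complex.I * τ * thetaTwo τ ^ 2 := by
  have h := jacobiTheta₂_functional_equation (τ / 2) τ
  have hexp : Complex.exp (π * Complex.I * τ / 4) *
      Complex.exp (-π * Complex.I * (τ / 2) ^ 2 / τ) = 1 := by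
    rw [← Complex.exp_add, ← Complex.exp_zero]
    congr 1
    field
  have h0 : -Complex.I * τ ≠ 0 := mul_ne_zero (neg_ne_zero.2 Complex.I_ne_zero) hτ
  rw [show τ / 2 / τ = 1 / 2 by field] at h
  rw [thetaFour, thetaTwo, h, show ∀ a b c d e : ℂ, a * (b * (1 / c * d * e)) ^ 2 =
    (b * d) ^ 2 * (a / c ^ 2 * e ^ 2) by intros; ring, hexp, cpow_half_sq, div_self h0]
  ring

theorem thetaTwo_neg_one_div {τ : ℂ} (hτ : τ ≠ 0) :
    thetaTwo (-1 / τ) ^ 2 = -Complex.I * τ * thetaFour τ ^ 2 := by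
  have h := thetaFour_neg_one_div (τ := -1 / τ) (div_ne_zero (neg_ne_zero.2 one_ne_zero) hτ)
  rw [show -1 / (-1 / τ) = τ by field] at h
  rw [h]
  field_simp
  rw [Complex.I_sq]
  ring

theorem tendsto_jacobiTheta : Tendsto jacobiTheta (comap Complex.im atTop) (𝓝 1) := by
  have hexp : Tendsto (fun τ : ℂ => Real.exp (-π * τ.im)) (comap Complex.im atTop) (𝓝 0) :=
    Real.tendsto_exp_atBot.comp
      (tendsto_comap.const_mul_atTop_of_neg (neg_lt_zero.2 Real.pi_pos))
  simpa using (isBigO_at_im_infty_jacobiTheta_sub_one.trans_tendsto hexp).add_const 1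

theorem tendsto_thetaFour : Tendsto thetaFour (comap Complex.im atTop) (𝓝 1) :=
  (tendsto_jacobiTheta.comp (tendsto_comap_iff.2 (tendsto_comap.congr fun τ => by simp))).congr
    jacobiTheta_add_one

theorem norm_jacobiTheta₂_term_half (n : ℤ) (τ : ℂ) :
    ‖jacobiTheta₂_term n (τ / 2) τ‖ = Real.exp (-(π * (n ^ 2 + n) * τ.im)) := by
  rw [norm_jacobiTheta₂_term, Complex.div_ofNat_im]
  ring_nf

theorem tendsto_jacobiTheta₂_term_half (n : ℤ) :
    Tendsto (fun τ => jacobiTheta₂_term n (τ / 2) τ) (comap Complex.im atTop)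
      (𝓝 (if n ∈ ({0, -1} : Finset ℤ) then 1 else 0)) := by
  split_ifs with hn
  · refine tendsto_const_nhds.congr fun τ => ?_
    rcases Finset.mem_insert.1 hn with rfl | hn
    · simp [jacobiTheta₂_term]
    · obtain rfl := Finset.mem_singleton.1 hn
      rw [jacobiTheta₂_term, show 2 * π * Complex.I * (-1 : ℤ) * (τ / 2) +
        π * Complex.I * (-1 : ℤ) ^ 2 * τ = 0 by push_cast; ring, Complex.exp_zero]
  · have hpos : (0 : ℝ) < π * (n ^ 2 + n) := by
      have : (0 : ℤ) < n ^ 2 + n := by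
        simp only [Finset.mem_insert, Finset.mem_singleton, not_or] at hn
        rcases lt_or_gt_of_ne hn.1 with h | h
        · nlinarith [show n ≤ -2 by lia]
        · positivity
      exact mul_pos Real.pi_pos (by exact_mod_cast this)
    rw [tendsto_zero_iff_norm_tendsto_zero]
    simp only [norm_jacobiTheta₂_term_half]
    exact Real.tendsto_exp_neg_atTop_nhds_zero.comp (tendsto_comap.const_mul_atTop hpos)

theorem tendsto_jacobiTheta₂_half :
    Tendsto (fun τ => jacobiTheta₂ (τ / 2) τ) (comap Complex.im atTop) (𝓝 2) := by
  have hsum : Summable fun n : ℤ => ‖jacobiTheta₂_term n (Complex.I / 2) Complex.I‖ :=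
    (hasSum_jacobiTheta₂_term _ (by simp)).summable.norm
  have h := tendsto_tsum_of_dominated_convergence hsum tendsto_jacobiTheta₂_term_half ?_
  · rw [tsum_eq_sum fun n hn => if_neg hn, Finset.sum_ite_mem] at h
    simpa [one_add_one_eq_two, jacobiTheta₂] using h
  · filter_upwards [tendsto_comap.eventually (eventually_ge_atTop 1)] with τ hτ n
    have hn : (0 : ℝ) ≤ n ^ 2 + n := by
      exact_mod_cast (show 0 ≤ n ^ 2 + n by rcases le_or_gt 0 n with h | h <;> nlinarith)
    rw [norm_jacobiTheta₂_term_half, norm_jacobiTheta₂_term_half, Complex.I_im, Real.exp_le_exp,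
      neg_le_neg_iff]
    gcongr

theorem tendsto_thetaTwo : Tendsto thetaTwo (comap Complex.im atTop) (𝓝 0) := by
  have hexp : Tendsto (fun τ : ℂ => Complex.exp (π * Complex.I * τ / 4)) (comap Complex.im atTop)
      (𝓝 0) := by
    rw [tendsto_zero_iff_norm_tendsto_zero]
    refine (Real.tendsto_exp_neg_atTop_nhds_zero.comp
      (tendsto_comap.const_mul_atTop (show 0 < π / 4 by positivity))).congr fun τ => ?_
    rw [Function.comp_apply, Complex.norm_exp, show π * Complex.I * τ / 4 =
      ((π / 4 : ℝ) : ℂ) * (Complex.I * τ) by push_cast; ring, Complex.re_ofReal_mul,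
      Complex.I_mul_re, mul_neg]
  simpa using (hexp.mul tendsto_jacobiTheta₂_half).congr fun τ => by rw [thetaTwo]

section

open scoped MatrixGroups ModularForm

theorem exists_cuspForm_of_transform {f : ℂ → ℂ} {k : ℤ}
    (hdiff : ∀ τ : ℂ, 0 < τ.im → DifferentiableAt ℂ f τ)
    (hT : ∀ τ : ℂ, 0 < τ.im → f (τ + 1) = f τ)
    (hS : ∀ τ : ℂ, 0 < τ.im → f (-1 / τ) = τ ^ k * f τ)
    (hzero : Tendsto f (comap Complex.im atTop) (𝓝 0)) :
    ∃ g : CuspForm 𝒮ℒ k, ∀ τ : ℍ, g τ = f τ := by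
  have hT' : ((fun τ : ℍ => f τ) ∣[k] ModularGroup.T) = fun τ : ℍ => f τ := by
    ext z
    rw [ModularForm.SL_slash_apply, modular_T_smul]
    simpa [denom, ModularGroup.coe_T, add_comm] using hT z z.im_pos
  have hS' : ((fun τ : ℍ => f τ) ∣[k] ModularGroup.S) = fun τ : ℍ => f τ := by
    ext z
    have h := hS z z.im_pos
    rw [neg_div, one_div, ← inv_neg] at h
    rw [ModularForm.SL_slash_apply, UpperHalfPlane.modular_S_smul, ModularGroup.denom_S, h,
      mul_right_comm, ← zpow_add₀ z.ne_zero, add_neg_cancel, zpow_zero, one_mul]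
  refine ⟨{ toFun := fun τ => f τ, slash_action_eq' := ?_, holo' := ?_, zero_at_cusps' := ?_},
    fun _ => rfl⟩
  · rintro _ ⟨A, rfl⟩
    exact SlashInvariantForm.slash_action_generators_SL2Z hS' hT' A
  · rw [UpperHalfPlane.mdifferentiable_iff]
    refine .congr (fun z hz => (hdiff z hz).differentiableWithinAt) fun z hz => ?_
    simp [ofComplex_apply_of_im_pos hz]
  · intro c hc
    rw [Subgroup.IsArithmetic.isCusp_iff_isCusp_SL2Z] at hc
    rw [OnePoint.isZeroAt_iff_forall_SL2Z hc]
    intro γ _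
    rw [SlashInvariantForm.slash_action_generators_SL2Z hS' hT']
    exact hzero.comp (tendsto_comap_iff.2 tendsto_comap)

theorem cexp_pi_mul_I_div_four_pow_four : Complex.exp (π * Complex.I / 4) ^ 4 = -1 := by
  rw [← Complex.exp_nat_mul, ← Complex.exp_pi_mul_I]
  congr 1
  push_cast
  ring

theorem cexp_pi_mul_I_div_four_pow_eight : Complex.exp (π * Complex.I / 4) ^ 8 = 1 := by
  rw [pow_mul _ 4 2, cexp_pi_mul_I_div_four_pow_four, neg_one_sq]

/- The square of the difference of the two sides is a cusp form of weight four, hence zero. -/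
theorem jacobiTheta_pow_four {τ : ℂ} (hτ : 0 < τ.im) :
    jacobiTheta τ ^ 4 = thetaTwo τ ^ 4 + thetaFour τ ^ 4 := by
  set f : ℂ → ℂ := fun τ => (jacobiTheta τ ^ 4 - thetaFour τ ^ 4 - thetaTwo τ ^ 4) ^ 2 with hf
  have hdiff (τ : ℂ) (hτ : 0 < τ.im) : DifferentiableAt ℂ f τ :=
    ((((differentiableAt_jacobiTheta hτ).pow 4).sub ((differentiableAt_thetaFour hτ).pow 4)).sub
      ((differentiableAt_thetaTwo hτ).pow 4)).pow 2
  have hT (τ : ℂ) : f (τ + 1) = f τ := by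
    simp only [hf, jacobiTheta_add_one, thetaFour_add_one, thetaTwo_add_one, mul_pow,
      cexp_pi_mul_I_div_four_pow_four]
    ring
  have hS (τ : ℂ) (hτ : 0 < τ.im) : f (-1 / τ) = τ ^ 4 * f τ := by
    have h0 : τ ≠ 0 := by rintro rfl; simp at hτ
    simp only [hf, fun x : ℂ => (by ring : x ^ 4 = (x ^ 2) ^ 2)]
    rw [jacobiTheta_neg_one_div hτ, thetaFour_neg_one_div h0, thetaTwo_neg_one_div h0]
    simp only [mul_pow, neg_sq, Complex.I_sq]
    ring
  have hzero : Tendsto f (comap Complex.im atTop) (𝓝 0) := by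
    simpa using (((tendsto_jacobiTheta.pow 4).sub (tendsto_thetaFour.pow 4)).sub
      (tendsto_thetaTwo.pow 4)).pow 2
  obtain ⟨g, hg⟩ := exists_cuspForm_of_transform (k := (4 : ℕ)) hdiff (fun τ _ => hT τ)
    (fun τ hτ => by exact_mod_cast hS τ hτ) hzero
  have hg0 : g = 0 := rank_zero_iff_forall_zero.1
    (CuspForm.rank_eq_zero_of_weight_lt_twelve (by norm_num)) g
  have hfτ : f τ = 0 := by rw [← hg ⟨τ, hτ⟩, hg0, zero_apply]
  linear_combination pow_eq_zero_iff two_ne_zero |>.1 hfτ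

theorem exists_theta_mul_pow_eight_eq :
    ∃ c : ℂ, ∀ τ : ℍ, (thetaTwo τ * jacobiTheta τ * thetaFour τ) ^ 8 =
      c * ModularForm.discriminant τ := by
  set f : ℂ → ℂ := fun τ => (thetaTwo τ * jacobiTheta τ * thetaFour τ) ^ 8 with hf
  have hdiff (τ : ℂ) (hτ : 0 < τ.im) : DifferentiableAt ℂ f τ :=
    (((differentiableAt_thetaTwo hτ).mul (differentiableAt_jacobiTheta hτ)).mul
      (differentiableAt_thetaFour hτ)).pow 8
  have hT (τ : ℂ) : f (τ + 1) = f τ := by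
    simp only [hf, jacobiTheta_add_one, thetaFour_add_one, thetaTwo_add_one, mul_pow,
      cexp_pi_mul_I_div_four_pow_eight]
    ring
  have hS (τ : ℂ) (hτ : 0 < τ.im) : f (-1 / τ) = τ ^ (12 : ℤ) * f τ := by
    have h0 : τ ≠ 0 := by rintro rfl; simp at hτ
    have hI : Complex.I ^ 12 = 1 := by rw [pow_mul _ 4 3, Complex.I_pow_four, one_pow]
    simp only [hf, fun x y z : ℂ => (by ring : (x * y * z) ^ 8 = (x ^ 2 * y ^ 2 * z ^ 2) ^ 4)]
    rw [jacobiTheta_neg_one_div hτ, thetaFour_neg_one_div h0, thetaTwo_neg_one_div h0]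
    norm_cast
    linear_combination τ ^ 12 * (thetaTwo τ * jacobiTheta τ * thetaFour τ) ^ 8 * hI
  have hzero : Tendsto f (comap Complex.im atTop) (𝓝 0) := by
    simpa using ((tendsto_thetaTwo.mul tendsto_jacobiTheta).mul tendsto_thetaFour).pow 8
  obtain ⟨g, hg⟩ := exists_cuspForm_of_transform hdiff (fun τ _ => hT τ) hS hzero
  obtain ⟨c, hc⟩ := CuspForm.exists_smul_discriminant_of_weight_eq_twelve g
  exact ⟨c, fun τ => (hg τ).symm.trans (by rw [← hc]; rfl)⟩

theorem theta_mul_pow_eight {τ : ℂ} (hτ : 0 < τ.im) :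
    (thetaTwo τ * jacobiTheta τ * thetaFour τ) ^ 8 = 256 * ModularForm.eta τ ^ 24 := by
  obtain ⟨c, hc⟩ := exists_theta_mul_pow_eight_eq
  have hprod (z : ℍ) : (jacobiTheta₂ (z / 2 : ℂ) z * jacobiTheta z * thetaFour z) ^ 8 =
      c * ∏' n, (1 - ModularForm.eta_q n z) ^ 24 := by
    have h := hc z
    have hq : Complex.exp (π * Complex.I * z / 4) ^ 8 = Function.Periodic.qParam 1 z := by
      rw [← Complex.exp_nat_mul, Function.Periodic.qParam]
      congr 1
      push_cast
      ring
    rw [ModularForm.discriminant_eq_q_prod, thetaTwo, ← hq] at h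
    refine mul_left_cancel₀ (pow_ne_zero 8 (Complex.exp_ne_zero (π * Complex.I * z / 4))) ?_
    linear_combination h
  have hlim := (((tendsto_jacobiTheta₂_half.mul tendsto_jacobiTheta).mul tendsto_thetaFour).pow
    8).comp (tendsto_comap_iff.2 tendsto_comap : Tendsto ((↑) : ℍ → ℂ) atImInfty _)
  have hconst := tendsto_nhds_unique (hlim.congr hprod)
    (ModularForm.tendsto_atImInfty_tprod_one_sub_eta_q_pow.const_mul c)
  have hc256 : c = 256 := by rw [← mul_one c, ← hconst]; norm_num
  rw [← hc256]
  exact hc ⟨τ, hτ⟩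

end

theorem tsum_eq_tsum_add_sub {F : ℤ × ℤ → ℂ} (hF : ∀ m n : ℤ, Odd (m + n) → F (m, n) = 0) :
    ∑' p, F p = ∑' p : ℤ × ℤ, F (p.1 + p.2, p.1 - p.2) := by
  refine (Function.Injective.tsum_eq (g := fun p : ℤ × ℤ => (p.1 + p.2, p.1 - p.2)) ?_ ?_).symm
  · rintro ⟨a, b⟩ ⟨c, d⟩ h
    simp only [Prod.mk.injEq] at h ⊢
    lia
  · rintro ⟨m, n⟩ h
    rcases Int.even_or_odd (m + n) with ⟨k, hk⟩ | hodd
    · exact ⟨(k, m - k), by simp only [Prod.mk.injEq]; lia⟩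
    · exact absurd (hF m n hodd) h

theorem tsum_mul_tsum_add_tsum_mul_tsum {u v u' v' : ℤ → ℂ} (hu : Summable (‖u ·‖))
    (hv : Summable (‖v ·‖)) (hu' : Summable (‖u' ·‖)) (hv' : Summable (‖v' ·‖))
    (h : ∀ m n, Odd (m + n) → u m * v n + u' m * v' n = 0) :
    (∑' m, u m) * (∑' n, v n) + (∑' m, u' m) * (∑' n, v' n) =
      ∑' p : ℤ × ℤ, (u (p.1 + p.2) * v (p.1 - p.2) + u' (p.1 + p.2) * v' (p.1 - p.2)) := by
  rw [tsum_mul_tsum_of_summable_norm hu hv, tsum_mul_tsum_of_summable_norm hu' hv',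
    ← Summable.tsum_add (summable_mul_of_summable_norm hu hv)
      (summable_mul_of_summable_norm hu' hv'), tsum_eq_tsum_add_sub h]

theorem jacobiTheta₂_term_zero (n : ℤ) (τ : ℂ) :
    jacobiTheta₂_term n 0 τ = Complex.exp (π * Complex.I * n ^ 2 * τ) := by
  rw [jacobiTheta₂_term, mul_zero, zero_add]

theorem jacobiTheta₂_term_one_half (n : ℤ) (τ : ℂ) :
    jacobiTheta₂_term n (1 / 2) τ = (-1) ^ n * jacobiTheta₂_term n 0 τ := by
  rw [jacobiTheta₂_term, jacobiTheta₂_term_zero, Complex.exp_add, ← Complex.exp_pi_mul_I,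
    ← Complex.exp_int_mul]
  ring_nf

theorem jacobiTheta₂_term_add_mul_sub (m n : ℤ) (τ : ℂ) :
    jacobiTheta₂_term (m + n) 0 τ * jacobiTheta₂_term (m - n) 0 τ =
      jacobiTheta₂_term m 0 (2 * τ) * jacobiTheta₂_term n 0 (2 * τ) := by
  simp only [jacobiTheta₂_term_zero, ← Complex.exp_add]
  push_cast
  ring_nf

theorem summable_norm_jacobiTheta₂_term (z : ℂ) {τ : ℂ} (hτ : 0 < τ.im) :
    Summable fun n => ‖jacobiTheta₂_term n z τ‖ :=
  (hasSum_jacobiTheta₂_term z hτ).summable.norm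

theorem jacobiTheta_sq_add_thetaFour_sq {τ : ℂ} (hτ : 0 < τ.im) :
    jacobiTheta τ ^ 2 + thetaFour τ ^ 2 = 2 * jacobiTheta (2 * τ) ^ 2 := by
  have hs (z : ℂ) := summable_norm_jacobiTheta₂_term z hτ
  have hs₂ := summable_norm_jacobiTheta₂_term 0 (τ := 2 * τ) (by simpa using hτ)
  rw [jacobiTheta_eq_jacobiTheta₂, jacobiTheta_eq_jacobiTheta₂, sq, sq, sq, thetaFour,
    jacobiTheta₂, jacobiTheta₂, jacobiTheta₂,
    tsum_mul_tsum_add_tsum_mul_tsum (hs _) (hs _) (hs _) (hs _),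
    tsum_mul_tsum_of_summable_norm hs₂ hs₂, ← tsum_mul_left]
  · refine tsum_congr fun p => ?_
    have hsign : (-1 : ℂ) ^ (p.1 + p.2) * (-1) ^ (p.1 - p.2) = 1 := by
      rw [← zpow_add₀ (by norm_num), (by lia : p.1 + p.2 + (p.1 - p.2) = 2 * p.1),
        (even_two_mul _).neg_one_zpow]
    rw [jacobiTheta₂_term_one_half, jacobiTheta₂_term_one_half, ← jacobiTheta₂_term_add_mul_sub]
    linear_combination jacobiTheta₂_term (p.1 + p.2) 0 τ * jacobiTheta₂_term (p.1 - p.2) 0 τ *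
      hsign
  · intro m n hmn
    have hsign : (-1 : ℂ) ^ m * (-1) ^ n = -1 := by
      rw [← zpow_add₀ (by norm_num), hmn.neg_one_zpow]
    rw [jacobiTheta₂_term_one_half, jacobiTheta₂_term_one_half]
    linear_combination jacobiTheta₂_term m 0 τ * jacobiTheta₂_term n 0 τ * hsign

theorem jacobiTheta_mul_thetaFour {τ : ℂ} (hτ : 0 < τ.im) :
    jacobiTheta τ * thetaFour τ = thetaFour (2 * τ) ^ 2 := by
  have hs (z : ℂ) := summable_norm_jacobiTheta₂_term z hτ
  have hs₂ := summable_norm_jacobiTheta₂_term (1 / 2) (τ := 2 * τ) (by simpa using hτ)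
  refine mul_left_cancel₀ (two_ne_zero (α := ℂ)) ?_
  rw [two_mul]
  nth_rewrite 2 [mul_comm]
  rw [jacobiTheta_eq_jacobiTheta₂, sq, thetaFour, thetaFour, jacobiTheta₂, jacobiTheta₂,
    jacobiTheta₂, tsum_mul_tsum_add_tsum_mul_tsum (hs _) (hs _) (hs _) (hs _),
    tsum_mul_tsum_of_summable_norm hs₂ hs₂, ← tsum_mul_left]
  · refine tsum_congr fun p => ?_
    have hsub : (-1 : ℂ) ^ (p.1 - p.2) = (-1) ^ (p.1 + p.2) := by
      rw [(by lia : p.1 + p.2 = p.1 - p.2 + 2 * p.2), zpow_add₀ (by norm_num),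
        (even_two_mul _).neg_one_zpow, mul_one]
    have hadd : (-1 : ℂ) ^ (p.1 + p.2) = (-1) ^ p.1 * (-1) ^ p.2 := zpow_add₀ (by norm_num) _ _
    simp only [jacobiTheta₂_term_one_half, hsub, hadd]
    linear_combination 2 * (-1) ^ p.1 * (-1) ^ p.2 * jacobiTheta₂_term_add_mul_sub p.1 p.2 τ
  · intro m n hmn
    have hsign : (-1 : ℂ) ^ m + (-1) ^ n = 0 := by
      rcases Int.even_or_odd m with hm | hm
      · rw [hm.neg_one_zpow, (Int.odd_add'.1 hmn |>.2 hm).neg_one_zpow, add_neg_cancel]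
      · rw [hm.neg_one_zpow, (Int.odd_add.1 hmn |>.1 hm).neg_one_zpow, neg_add_cancel]
    rw [jacobiTheta₂_term_one_half, jacobiTheta₂_term_one_half]
    linear_combination jacobiTheta₂_term m 0 τ * jacobiTheta₂_term n 0 τ * hsign

theorem conj_jacobiTheta (τ : ℂ) :
    (starRingEnd ℂ) (jacobiTheta τ) = jacobiTheta (-(starRingEnd ℂ) τ) := by
  rw [jacobiTheta_eq_jacobiTheta₂, jacobiTheta_eq_jacobiTheta₂, jacobiTheta₂_conj, map_zero]

theorem conj_thetaFour (τ : ℂ) :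
    (starRingEnd ℂ) (thetaFour τ) = thetaFour (-(starRingEnd ℂ) τ) := by
  rw [thetaFour, thetaFour, jacobiTheta₂_conj, map_div₀, map_one, Complex.conj_ofNat]

theorem conj_thetaTwo (τ : ℂ) :
    (starRingEnd ℂ) (thetaTwo τ) = thetaTwo (-(starRingEnd ℂ) τ) := by
  rw [thetaTwo, thetaTwo, map_mul, jacobiTheta₂_conj, ← Complex.exp_conj, neg_div,
    jacobiTheta₂_neg_left]
  simp only [map_div₀, map_mul, Complex.conj_ofReal, Complex.conj_I, Complex.conj_ofNat]
  ring_nf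

theorem conj_eta {τ : ℂ} (hτ : 0 < τ.im) :
    (starRingEnd ℂ) (ModularForm.eta τ) = ModularForm.eta (-(starRingEnd ℂ) τ) := by
  have hexp (w z : ℂ) (hw : (starRingEnd ℂ) w = w) :
      (starRingEnd ℂ) (Complex.exp (2 * π * Complex.I * z / w)) =
        Complex.exp (2 * π * Complex.I * -(starRingEnd ℂ) z / w) := by
    rw [← Complex.exp_conj]
    simp [hw, Complex.conj_ofNat]
  have hm := ModularForm.multipliableLocallyUniformlyOn_eta.multipliable (x := τ) hτ
  rw [ModularForm.eta, ModularForm.eta, map_mul,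
    hm.map_tprod (starRingEnd ℂ) Complex.continuous_conj]
  congr 1
  · simpa [Function.Periodic.qParam] using hexp 24 τ (Complex.conj_ofNat 24)
  · refine tprod_congr fun n => ?_
    have h := hexp 1 τ (map_one _)
    rw [div_one, div_one] at h
    rw [ModularForm.eta_q_eq_pow, ModularForm.eta_q_eq_pow, map_sub, map_one, map_pow, h]

theorem neg_conj_I_mul (y : ℝ) : -(starRingEnd ℂ) (Complex.I * y) = Complex.I * y := by
  simp

theorem ofReal_re_of_conj {f : ℂ → ℂ} {y : ℝ}
    (hf : (starRingEnd ℂ) (f (Complex.I * y)) = f (-(starRingEnd ℂ) (Complex.I * y))) :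
    ((f (Complex.I * y)).re : ℂ) = f (Complex.I * y) := by
  rwa [neg_conj_I_mul, Complex.conj_eq_iff_re] at hf

/-- The square of a function on the imaginary axis, as a real function; meant for functions with
`conj (f τ) = f (-conj τ)`, which are real there. -/
def imAxisSq (f : ℂ → ℂ) (y : ℝ) : ℝ := (f (Complex.I * y)).re ^ 2

theorem ofReal_imAxisSq {f : ℂ → ℂ} (hf : ∀ τ, (starRingEnd ℂ) (f τ) = f (-(starRingEnd ℂ) τ))
    (y : ℝ) : (imAxisSq f y : ℂ) = f (Complex.I * y) ^ 2 := by
  rw [imAxisSq, Complex.ofReal_pow, ofReal_re_of_conj (hf _)]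

theorem imAxisSq_pos {f : ℂ → ℂ} (hf : ∀ τ, (starRingEnd ℂ) (f τ) = f (-(starRingEnd ℂ) τ))
    {y : ℝ} (hy : f (Complex.I * y) ≠ 0) : 0 < imAxisSq f y := by
  rw [← ofReal_re_of_conj (hf _)] at hy
  exact sq_pos_of_ne_zero (by exact_mod_cast hy)

theorem imAxisSq_inv {f g : ℂ → ℂ} (hf : ∀ τ, (starRingEnd ℂ) (f τ) = f (-(starRingEnd ℂ) τ))
    (hg : ∀ τ, (starRingEnd ℂ) (g τ) = g (-(starRingEnd ℂ) τ)) {y : ℝ}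
    (h : f (-1 / (Complex.I * y)) ^ 2 =
      -Complex.I * (Complex.I * y) * g (Complex.I * y) ^ 2) :
    imAxisSq f y⁻¹ = y * imAxisSq g y := by
  rw [← I_mul_inv_eq_neg_one_div, ← ofReal_imAxisSq hf, ← ofReal_imAxisSq hg, ← mul_assoc, neg_mul,
    Complex.I_mul_I, neg_neg, one_mul] at h
  exact_mod_cast h

theorem tendsto_imAxisSq {f : ℂ → ℂ} {c : ℂ} (hf : Tendsto f (comap Complex.im atTop) (𝓝 c)) :
    Tendsto (imAxisSq f) atTop (𝓝 (c.re ^ 2)) := by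
  have hI : Tendsto (fun y : ℝ => Complex.I * (y : ℂ)) atTop (comap Complex.im atTop) :=
    tendsto_comap_iff.2 (tendsto_id.congr fun y => by simp)
  exact ((Complex.continuous_re.tendsto c).comp (hf.comp hI)).pow 2

theorem imAxisSq_jacobiTheta_inv {y : ℝ} (hy : 0 < y) :
    imAxisSq jacobiTheta y⁻¹ = y * imAxisSq jacobiTheta y :=
  imAxisSq_inv conj_jacobiTheta conj_jacobiTheta (jacobiTheta_neg_one_div (by simpa using hy))

theorem imAxisSq_thetaTwo_inv {y : ℝ} (hy : 0 < y) :
    imAxisSq thetaTwo y⁻¹ = y * imAxisSq thetaFour y :=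
  imAxisSq_inv conj_thetaTwo conj_thetaFour (thetaTwo_neg_one_div (by simpa using hy.ne'))

theorem theta_mul_ne_zero {τ : ℂ} (hτ : 0 < τ.im) :
    thetaTwo τ * jacobiTheta τ * thetaFour τ ≠ 0 := by
  refine ne_zero_pow (n := 8) (by norm_num) ?_
  rw [theta_mul_pow_eight hτ]
  exact mul_ne_zero (by norm_num) (pow_ne_zero _ (ModularForm.eta_ne_zero hτ))

theorem imAxisSq_thetaTwo_pos {y : ℝ} (hy : 0 < y) : 0 < imAxisSq thetaTwo y :=
  imAxisSq_pos conj_thetaTwo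
    (left_ne_zero_of_mul (left_ne_zero_of_mul (theta_mul_ne_zero (by simpa using hy))))

theorem imAxisSq_jacobiTheta_pos {y : ℝ} (hy : 0 < y) : 0 < imAxisSq jacobiTheta y :=
  imAxisSq_pos conj_jacobiTheta
    (right_ne_zero_of_mul (left_ne_zero_of_mul (theta_mul_ne_zero (by simpa using hy))))

theorem imAxisSq_thetaFour_pos {y : ℝ} (hy : 0 < y) : 0 < imAxisSq thetaFour y :=
  imAxisSq_pos conj_thetaFour (right_ne_zero_of_mul (theta_mul_ne_zero (by simpa using hy)))

theorem imAxisSq_jacobiTheta_sq {y : ℝ} (hy : 0 < y) :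
    imAxisSq jacobiTheta y ^ 2 = imAxisSq thetaTwo y ^ 2 + imAxisSq thetaFour y ^ 2 := by
  have h := jacobiTheta_pow_four (τ := Complex.I * y) (by simpa using hy)
  simp only [pow_mul _ 2 2, ← ofReal_imAxisSq conj_jacobiTheta, ← ofReal_imAxisSq conj_thetaTwo,
    ← ofReal_imAxisSq conj_thetaFour] at h
  exact_mod_cast h

theorem imAxisSq_jacobiTheta_two_mul {y : ℝ} (hy : 0 < y) :
    imAxisSq jacobiTheta (2 * y) = (imAxisSq jacobiTheta y + imAxisSq thetaFour y) / 2 := by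
  have h := jacobiTheta_sq_add_thetaFour_sq (τ := Complex.I * y) (by simpa using hy)
  rw [mul_left_comm, ← Complex.ofReal_ofNat, ← Complex.ofReal_mul,
    ← ofReal_imAxisSq conj_jacobiTheta, ← ofReal_imAxisSq conj_jacobiTheta,
    ← ofReal_imAxisSq conj_thetaFour] at h
  rw [eq_div_iff two_ne_zero, mul_comm]
  exact_mod_cast h.symm

theorem imAxisSq_thetaFour_two_mul_sq {y : ℝ} (hy : 0 < y) :
    imAxisSq thetaFour (2 * y) ^ 2 = imAxisSq jacobiTheta y * imAxisSq thetaFour y := by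
  have h := congrArg (· ^ 2) (jacobiTheta_mul_thetaFour (τ := Complex.I * y) (by simpa using hy))
  simp only [mul_pow] at h
  rw [mul_left_comm, ← Complex.ofReal_ofNat, ← Complex.ofReal_mul,
    ← ofReal_imAxisSq conj_jacobiTheta, ← ofReal_imAxisSq conj_thetaFour,
    ← ofReal_imAxisSq conj_thetaFour] at h
  exact_mod_cast h.symm

theorem etaTwelve_I_mul {y : ℝ} (hy : 0 < y) :
    etaTwelve (Complex.I * y) =
      ((imAxisSq thetaTwo y * imAxisSq jacobiTheta y * imAxisSq thetaFour y) ^ 2 / 16 : ℝ) := by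
  have him : 0 < (Complex.I * y).im := by simpa using hy
  have hη := ofReal_re_of_conj (conj_eta him)
  set r := (ModularForm.eta (Complex.I * y)).re
  set P := (imAxisSq thetaTwo y * imAxisSq jacobiTheta y * imAxisSq thetaFour y) ^ 2 / 16 with hP
  have hsq : ((P ^ 2 : ℝ) : ℂ) = ((r ^ 12) ^ 2 : ℝ) := by
    rw [hP, ← pow_mul, Complex.ofReal_pow r, hη]
    push_cast
    rw [ofReal_imAxisSq conj_thetaTwo, ofReal_imAxisSq conj_jacobiTheta,
      ofReal_imAxisSq conj_thetaFour]
    linear_combination theta_mul_pow_eight him / 256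
  have hPr : P = r ^ 12 :=
    (pow_left_inj₀ (by positivity) (by positivity) two_ne_zero).1 (by exact_mod_cast hsq)
  rw [etaTwelve, ← hη, hPr, Complex.ofReal_pow]

/-! ### Landen's transformation -/

theorem eq_of_hasDerivAt_zero {f : ℝ → ℝ} {p q x : ℝ} (hf : ContinuousOn f (Ico p q))
    (hf' : ∀ y ∈ Ioo p q, HasDerivAt f 0 y) (hx : x ∈ Ico p q) : f x = f p := by
  rcases hx.1.eq_or_lt with rfl | hpx
  · rfl
  · obtain ⟨_, _, hc⟩ := exists_hasDerivAt_eq_slope f (fun _ => 0) hpx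
      (hf.mono (Icc_subset_Ico_right hx.2)) fun y hy => hf' y ⟨hy.1, hy.2.trans hx.2⟩
    rw [eq_div_iff (sub_pos.2 hpx).ne', zero_mul] at hc
    exact (sub_eq_zero.1 hc.symm)

/- The Wronskian `u * V - v * U` is constant, hence zero, and it is the numerator of the derivative
of `u / v` up to the factor `a`. -/
theorem div_eq_div_of_linear_system {a b u U v V : ℝ → ℝ} {p q x : ℝ}
    (hu : ContinuousOn u (Ico p q)) (hU : ContinuousOn U (Ico p q))
    (hv : ContinuousOn v (Ico p q)) (hV : ContinuousOn V (Ico p q))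
    (hu' : ∀ y ∈ Ioo p q, HasDerivAt u (a y * U y) y)
    (hU' : ∀ y ∈ Ioo p q, HasDerivAt U (b y * u y) y)
    (hv' : ∀ y ∈ Ioo p q, HasDerivAt v (a y * V y) y)
    (hV' : ∀ y ∈ Ioo p q, HasDerivAt V (b y * v y) y)
    (hUp : U p = 0) (hVp : V p = 0) (hv0 : ∀ y ∈ Ico p q, v y ≠ 0) (hx : x ∈ Ico p q) :
    u x / v x = u p / v p := by
  have hwronskian (y : ℝ) (hy : y ∈ Ico p q) : u y * V y - v y * U y = 0 := by
    have h := eq_of_hasDerivAt_zero ((hu.mul hV).sub (hv.mul hU)) (fun y hy =>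
      (((hu' y hy).mul (hV' y hy)).sub ((hv' y hy).mul (hU' y hy))).congr_deriv (by ring)) hy
    simpa [hUp, hVp] using h
  refine eq_of_hasDerivAt_zero (f := fun x => u x / v x) (hu.div hv hv0) (fun y hy => ?_) hx
  have hy' := Ioo_subset_Ico_self hy
  refine ((hu' y hy).div (hv' y hy) (hv0 y hy')).congr_deriv ?_
  rw [div_eq_zero_iff]
  left
  linear_combination -a y * hwronskian y hy'

/-- The argument `4x / (1 + x)²` of Landen's transformation. -/
def landenArg (x : ℝ) : ℝ := 4 * x / (1 + x) ^ 2

theorem landenArg_zero : landenArg 0 = 0 := by simp [landenArg]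

theorem one_sub_landenArg {x : ℝ} (hx : 1 + x ≠ 0) :
    1 - landenArg x = ((1 - x) / (1 + x)) ^ 2 := by
  rw [landenArg]
  field

theorem abs_landenArg_lt_one {x : ℝ} (hx : x ∈ Ico (0 : ℝ) 1) : |landenArg x| < 1 := by
  have h0 : 0 < 1 + x := by linarith [hx.1]
  have h1 : 0 < 1 - x := by linarith [hx.2]
  have h : 0 < 1 - landenArg x := by
    rw [one_sub_landenArg h0.ne']
    positivity
  have hnonneg : 0 ≤ landenArg x := div_nonneg (by linarith [hx.1]) (sq_nonneg _)
  rw [abs_of_nonneg hnonneg]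
  linarith

theorem hasDerivAt_landenArg {x : ℝ} (hx : 1 + x ≠ 0) :
    HasDerivAt landenArg (4 * (1 - x) / (1 + x) ^ 3) x := by
  refine (((hasDerivAt_id' x).const_mul 4).fun_div (((hasDerivAt_id' x).const_add 1).fun_pow 2)
    (pow_ne_zero 2 hx)).congr_deriv ?_
  field

theorem hasDerivAt_ellF_landenArg {x : ℝ} (hx : x ∈ Ico (0 : ℝ) 1) :
    HasDerivAt (fun x => ellF (landenArg x)) (4 * ellG (landenArg x) / ((1 - x) * (1 + x))) x := by
  have h0 : 1 + x ≠ 0 := by linarith [hx.1]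
  have h1 : 1 - x ≠ 0 := by linarith [hx.2]
  refine ((hasDerivAt_ellF (abs_landenArg_lt_one hx)).comp x
    (hasDerivAt_landenArg h0)).congr_deriv ?_
  rw [one_sub_landenArg h0]
  field

theorem hasDerivAt_landenArg_mul_ellG {x : ℝ} (hx : x ∈ Ico (0 : ℝ) 1) :
    HasDerivAt (fun x => landenArg x * ellG (landenArg x))
      ((1 - x) / (1 + x) ^ 3 * ellF (landenArg x)) x := by
  have h0 : 1 + x ≠ 0 := by linarith [hx.1]
  refine (HasDerivAt.comp (h₂ := fun t => t * ellG t) x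
    (hasDerivAt_mul_ellG (abs_landenArg_lt_one hx)) (hasDerivAt_landenArg h0)).congr_deriv ?_
  field

theorem abs_sq_lt_one {x : ℝ} (hx : x ∈ Ico (0 : ℝ) 1) : |x ^ 2| < 1 := by
  rw [abs_pow, abs_of_nonneg hx.1]
  exact pow_lt_one₀ hx.1 hx.2 two_ne_zero

theorem hasDerivAt_ellF_sq {x : ℝ} (hx : x ∈ Ico (0 : ℝ) 1) :
    HasDerivAt (fun x => ellF (x ^ 2)) (2 * x * ellG (x ^ 2) / ((1 - x) * (1 + x))) x := by
  refine (HasDerivAt.comp (h₂ := ellF) (h := (· ^ 2)) x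
    (hasDerivAt_ellF (abs_sq_lt_one hx)) (hasDerivAt_pow 2 x)).congr_deriv ?_
  rw [show 1 - x ^ 2 = (1 - x) * (1 + x) by ring]
  push_cast
  ring

theorem hasDerivAt_one_add_mul_ellF_sq {x : ℝ} (hx : x ∈ Ico (0 : ℝ) 1) :
    HasDerivAt (fun x => (1 + x) * ellF (x ^ 2))
      (ellF (x ^ 2) + 2 * x * ellG (x ^ 2) / (1 - x)) x := by
  have h0 : 1 + x ≠ 0 := by linarith [hx.1]
  have h1 : 1 - x ≠ 0 := by linarith [hx.2]
  refine (((hasDerivAt_id' x).const_add 1).mul (hasDerivAt_ellF_sq hx)).congr_deriv ?_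
  field

/-- The companion of `(1 + x) F(x²)` in the linear system satisfied by both sides of Landen's
transformation. -/
def landenCompanion (x : ℝ) : ℝ :=
  (x * (1 - x) * ellF (x ^ 2) + 2 * (x ^ 2 * ellG (x ^ 2))) / (1 + x)

theorem hasDerivAt_landenCompanion {x : ℝ} (hx : x ∈ Ico (0 : ℝ) 1) :
    HasDerivAt landenCompanion ((1 - x) / (1 + x) ^ 3 * ((1 + x) * ellF (x ^ 2))) x := by
  have h0 : 1 + x ≠ 0 := by linarith [hx.1]
  have h1 : 1 - x ≠ 0 := by linarith [hx.2]
  have hG : HasDerivAt (fun x => x ^ 2 * ellG (x ^ 2)) (ellF (x ^ 2) / 4 * (2 * x)) x :=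
    (HasDerivAt.comp (h₂ := fun t => t * ellG t) (h := (· ^ 2)) x
      (hasDerivAt_mul_ellG (abs_sq_lt_one hx)) (hasDerivAt_pow 2 x)).congr_deriv
        (by push_cast; ring)
  refine (((((hasDerivAt_id' x).mul ((hasDerivAt_id' x).const_sub 1)).mul
    (hasDerivAt_ellF_sq hx)).add (hG.const_mul 2)).fun_div ((hasDerivAt_id' x).const_add 1)
    h0).congr_deriv ?_
  simp only [Pi.mul_apply, Pi.add_apply]
  field

/- Both sides are first components of solutions `(u, U)` of the linear system
`u' = (1 + x) / (x (1 - x)) U`, `U' = (1 - x) / (1 + x)³ u` with `u 0 = 1`, `U 0 = 0`. -/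
theorem ellF_landenArg {x : ℝ} (hx : x ∈ Ico (0 : ℝ) 1) :
    ellF (landenArg x) = (1 + x) * ellF (x ^ 2) := by
  have hne (x : ℝ) (hx : x ∈ Ico (0 : ℝ) 1) : (1 + x) * ellF (x ^ 2) ≠ 0 :=
    mul_ne_zero (by linarith [hx.1])
      (ellF_pos (sq_nonneg x) (lt_of_abs_lt (abs_sq_lt_one hx))).ne'
  have h := div_eq_div_of_linear_system (a := fun x => (1 + x) / (x * (1 - x)))
    (b := fun x => (1 - x) / (1 + x) ^ 3)
    (fun x hx => (hasDerivAt_ellF_landenArg hx).continuousAt.continuousWithinAt)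
    (fun x hx => (hasDerivAt_landenArg_mul_ellG hx).continuousAt.continuousWithinAt)
    (fun x hx => (hasDerivAt_one_add_mul_ellF_sq hx).continuousAt.continuousWithinAt)
    (fun x hx => (hasDerivAt_landenCompanion hx).continuousAt.continuousWithinAt)
    (fun x hx => (hasDerivAt_ellF_landenArg (Ioo_subset_Ico_self hx)).congr_deriv ?_)
    (fun x hx => hasDerivAt_landenArg_mul_ellG (Ioo_subset_Ico_self hx))
    (fun x hx => (hasDerivAt_one_add_mul_ellF_sq (Ioo_subset_Ico_self hx)).congr_deriv ?_)
    (fun x hx => hasDerivAt_landenCompanion (Ioo_subset_Ico_self hx))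
    (by rw [landenArg_zero, zero_mul]) (by simp [landenCompanion]) hne hx
  · simpa [landenArg_zero, ellF_zero, div_eq_one_iff_eq (hne x hx)] using h
  all_goals
    have h0 : x ≠ 0 := hx.1.ne'
    have h1 : 1 - x ≠ 0 := by linarith [hx.2]
    have h2 : 1 + x ≠ 0 := by linarith [hx.1]
  · rw [landenArg]
    field
  · rw [landenCompanion]
    field

theorem ellF_one_sub_sq {k : ℝ} (hk : k ∈ Ioc (0 : ℝ) 1) :
    ellF (1 - k ^ 2) = 2 / (1 + k) * ellF (((1 - k) / (1 + k)) ^ 2) := by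
  have h0 : 0 < 1 + k := by linarith [hk.1]
  have h := ellF_landenArg (x := (1 - k) / (1 + k))
    ⟨div_nonneg (by linarith [hk.2]) h0.le, (div_lt_one h0).2 (by linarith [hk.1])⟩
  rw [show 1 + (1 - k) / (1 + k) = 2 / (1 + k) by field, landenArg] at h
  rw [← h]
  congr 1
  field

/-! ### The modular lambda function and the ratio of periods -/

/-- The modular lambda function `λ(iy)` on the imaginary axis. -/
def lambdaImAxis (y : ℝ) : ℝ := (imAxisSq thetaTwo y / imAxisSq jacobiTheta y) ^ 2

theorem one_sub_lambdaImAxis {y : ℝ} (hy : 0 < y) :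
    1 - lambdaImAxis y = (imAxisSq thetaFour y / imAxisSq jacobiTheta y) ^ 2 := by
  have h := (imAxisSq_jacobiTheta_pos hy).ne'
  rw [lambdaImAxis]
  field_simp
  linear_combination imAxisSq_jacobiTheta_sq hy

theorem lambdaImAxis_mem_Ioo {y : ℝ} (hy : 0 < y) : lambdaImAxis y ∈ Ioo (0 : ℝ) 1 := by
  have h₂ := imAxisSq_thetaTwo_pos hy
  have h₃ := imAxisSq_jacobiTheta_pos hy
  have h₄ := imAxisSq_thetaFour_pos hy
  refine ⟨by rw [lambdaImAxis]; positivity, sub_pos.1 ?_⟩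
  rw [one_sub_lambdaImAxis hy]
  positivity

theorem lambdaImAxis_inv {y : ℝ} (hy : 0 < y) : lambdaImAxis y⁻¹ = 1 - lambdaImAxis y := by
  rw [one_sub_lambdaImAxis hy, lambdaImAxis, imAxisSq_thetaTwo_inv hy,
    imAxisSq_jacobiTheta_inv hy, mul_div_mul_left _ _ hy.ne']

theorem tendsto_lambdaImAxis : Tendsto lambdaImAxis atTop (𝓝 0) := by
  simpa using (((tendsto_imAxisSq tendsto_thetaTwo).div (tendsto_imAxisSq tendsto_jacobiTheta)
    (by simp)).pow 2).congr fun y => by simp [lambdaImAxis]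

theorem ellF_lambdaImAxis_two_mul {y : ℝ} (hy : 0 < y) :
    ellF (lambdaImAxis (2 * y)) / imAxisSq jacobiTheta (2 * y) =
      ellF (lambdaImAxis y) / imAxisSq jacobiTheta y := by
  have h₃ := imAxisSq_jacobiTheta_pos hy
  have h₄ := imAxisSq_thetaFour_pos hy
  set k := imAxisSq thetaFour y / imAxisSq jacobiTheta y with hk
  have hsub : 1 - lambdaImAxis y = k ^ 2 := one_sub_lambdaImAxis hy
  have hk0 : 0 < k := div_pos h₄ h₃
  have hk1 : k ≤ 1 := by
    rw [← sq_le_one_iff₀ hk0.le, ← hsub]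
    linarith [(lambdaImAxis_mem_Ioo hy).1]
  have hdouble : lambdaImAxis (2 * y) = ((1 - k) / (1 + k)) ^ 2 := by
    rw [← sub_sub_cancel 1 (lambdaImAxis (2 * y)), one_sub_lambdaImAxis (by positivity), div_pow,
      imAxisSq_thetaFour_two_mul_sq hy, imAxisSq_jacobiTheta_two_mul hy, hk]
    field
  rw [hdouble, ← sub_sub_cancel 1 (lambdaImAxis y), hsub, ellF_one_sub_sq ⟨hk0, hk1⟩,
    imAxisSq_jacobiTheta_two_mul hy, hk]
  field

/- The ratio of the two sides is invariant under `y ↦ 2 * y` and tends to `1` at infinity. -/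
theorem ellF_lambdaImAxis {y : ℝ} (hy : 0 < y) :
    ellF (lambdaImAxis y) = imAxisSq jacobiTheta y := by
  have hinvariant (n : ℕ) : ellF (lambdaImAxis (2 ^ n * y)) / imAxisSq jacobiTheta (2 ^ n * y) =
      ellF (lambdaImAxis y) / imAxisSq jacobiTheta y := by
    induction n with
    | zero => rw [pow_zero, one_mul]
    | succ n ih => rw [pow_succ', mul_assoc, ellF_lambdaImAxis_two_mul (by positivity), ih]
  have hpow : Tendsto (fun n : ℕ => (2 : ℝ) ^ n * y) atTop atTop :=
    (tendsto_pow_atTop_atTop_of_one_lt one_lt_two).atTop_mul_const hy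
  have hF : Tendsto (fun y => ellF (lambdaImAxis y)) atTop (𝓝 (ellF 0)) :=
    (hasDerivAt_ellF (by simp)).continuousAt.tendsto.comp tendsto_lambdaImAxis
  have hratio := (hF.div (tendsto_imAxisSq tendsto_jacobiTheta) (by simp)).comp hpow
  have h := tendsto_nhds_unique (hratio.congr hinvariant) tendsto_const_nhds
  rw [ellF_zero, Complex.one_re, one_pow, div_one, eq_comm,
    div_eq_one_iff_eq (imAxisSq_jacobiTheta_pos hy).ne'] at h
  exact h

/-- The ratio `K(1 - t) / K(t)` of complementary complete elliptic integrals. -/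
def ellRatio (t : ℝ) : ℝ := ellF (1 - t) / ellF t

theorem ellRatio_lambdaImAxis {y : ℝ} (hy : 0 < y) : ellRatio (lambdaImAxis y) = y := by
  rw [ellRatio, ← lambdaImAxis_inv hy, ellF_lambdaImAxis (inv_pos.2 hy), ellF_lambdaImAxis hy,
    imAxisSq_jacobiTheta_inv hy, mul_div_cancel_right₀ _ (imAxisSq_jacobiTheta_pos hy).ne']

theorem legendre_relation {t : ℝ} (ht : t ∈ Ioo (0 : ℝ) 1) :
    t * ellG t * ellF (1 - t) + ellF t * ((1 - t) * ellG (1 - t)) = 1 / π := by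
  set L : ℝ → ℝ := fun t => t * ellG t * ellF (1 - t) + ellF t * ((1 - t) * ellG (1 - t))
  have hderiv (t : ℝ) (ht : t ∈ Ioo (0 : ℝ) 1) : HasDerivAt L 0 t := by
    have h0 : t ≠ 0 := ht.1.ne'
    have h1 : 1 - t ≠ 0 := by linarith [ht.2]
    refine (((hasDerivAt_mul_ellG (abs_lt_one_of_mem_Ioo ht)).mul (hasDerivAt_ellF_one_sub ht)).add
      ((hasDerivAt_ellF (abs_lt_one_of_mem_Ioo ht)).mul
        (hasDerivAt_one_sub_mul_ellG ht))).congr_deriv ?_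
    field
  have hconst (s : ℝ) (hs : s ∈ Ioo (0 : ℝ) 1) : L t = L s :=
    isOpen_Ioo.is_const_of_deriv_eq_zero isPreconnected_Ioo
      (fun x hx => (hderiv x hx).differentiableAt.differentiableWithinAt)
      (fun x hx => (hderiv x hx).deriv) ht hs
  have hzero : Tendsto L (𝓝[>] 0) (𝓝 (1 / π)) := by
    have h := (tendsto_ellG_zero.mul tendsto_mul_ellF_one_sub).add
      (tendsto_ellF_zero.mul (tendsto_one_sub_nhdsGT_zero_one.mul tendsto_ellG_one_sub))
    rw [mul_zero, zero_add, one_mul, one_mul] at h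
    exact h.congr fun t => by ring
  refine tendsto_nhds_unique (tendsto_const_nhds.congr' ?_) hzero
  filter_upwards [Ioo_mem_nhdsGT one_pos] with s hs using hconst s hs

theorem hasDerivAt_ellRatio {t : ℝ} (ht : t ∈ Ioo (0 : ℝ) 1) :
    HasDerivAt ellRatio (-(1 / (π * (t * (1 - t) * ellF t ^ 2)))) t := by
  have h0 : t ≠ 0 := ht.1.ne'
  have h1 : 1 - t ≠ 0 := by linarith [ht.2]
  have hF : ellF t ≠ 0 := (ellF_pos ht.1.le ht.2).ne'
  refine ((hasDerivAt_ellF_one_sub ht).div (hasDerivAt_ellF (abs_lt_one_of_mem_Ioo ht))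
    hF).congr_deriv ?_
  rw [← div_div, ← legendre_relation ht]
  field

theorem injOn_ellRatio : InjOn ellRatio (Ioo 0 1) := by
  refine StrictAntiOn.injOn (strictAntiOn_of_deriv_neg (convex_Ioo 0 1) (fun t ht =>
    (hasDerivAt_ellRatio ht).continuousAt.continuousWithinAt) fun t ht => ?_)
  rw [interior_Ioo] at ht
  have h0 := ht.1
  have h1 := sub_pos.2 ht.2
  have hF := ellF_pos ht.1.le ht.2
  rw [(hasDerivAt_ellRatio ht).deriv, neg_lt_zero]
  positivity

theorem ellRatio_pos {t : ℝ} (ht : t ∈ Ioo (0 : ℝ) 1) : 0 < ellRatio t :=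
  div_pos (ellF_one_sub_pos ht) (ellF_pos ht.1.le ht.2)

theorem image_ellRatio : ellRatio '' Ioo 0 1 = Ioi 0 := by
  ext y
  constructor
  · rintro ⟨t, ht, rfl⟩
    exact ellRatio_pos ht
  · exact fun hy => ⟨lambdaImAxis y, lambdaImAxis_mem_Ioo hy, ellRatio_lambdaImAxis hy⟩

theorem lambdaImAxis_ellRatio {t : ℝ} (ht : t ∈ Ioo (0 : ℝ) 1) :
    lambdaImAxis (ellRatio t) = t :=
  injOn_ellRatio (lambdaImAxis_mem_Ioo (ellRatio_pos ht)) ht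
    (ellRatio_lambdaImAxis (ellRatio_pos ht))

theorem etaTwelve_ellRatio {t : ℝ} (ht : t ∈ Ioo (0 : ℝ) 1) :
    etaTwelve (Complex.I * ellRatio t) = (t * (1 - t) * ellF t ^ 6 / 16 : ℝ) := by
  have hy := ellRatio_pos ht
  have hθ := (imAxisSq_jacobiTheta_pos hy).ne'
  have h₂ := lambdaImAxis_ellRatio ht
  have h₃ := ellF_lambdaImAxis hy
  have h₄ := one_sub_lambdaImAxis hy
  rw [h₂] at h₃ h₄
  rw [lambdaImAxis] at h₂
  generalize ellRatio t = y at *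
  rw [etaTwelve_I_mul hy, h₃, h₄, ← h₂]
  congr 1
  field

theorem etaMellin_three : etaMellin 3 = (1 / (16 * π) * ∫ t in (0 : ℝ)..1, ellW t ^ 2 : ℝ) := by
  have h := integral_etaTwelve_mul_pow 2
  rw [← image_ellRatio, integral_image_eq_integral_abs_deriv_smul measurableSet_Ioo
    (fun t ht => (hasDerivAt_ellRatio ht).hasDerivWithinAt) injOn_ellRatio,
    Nat.cast_ofNat, two_add_one_eq_three] at h
  rw [← h, intervalIntegral.integral_of_le zero_le_one, integral_Ioc_eq_integral_Ioo,
    ← integral_const_mul, ← integral_complex_ofReal]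
  refine setIntegral_congr_fun measurableSet_Ioo fun t ht => ?_
  have h0 := ht.1
  have h1 := sub_pos.2 ht.2
  have hF := ellF_pos ht.1.le ht.2
  rw [etaTwelve_ellRatio ht, abs_neg, abs_of_pos (by positivity), Complex.real_smul]
  norm_cast
  rw [ellRatio, ellW]
  field

/-! ### The L-value and the hypergeometric series -/

theorem etaTwoPowTwelve_I_mul {x : ℝ} (hx : 0 < x) :
    etaTwoPowTwelve (ofComplex (Complex.I * x)) = etaTwelve (Complex.I * ((2 * x : ℝ) : ℂ)) := by
  rw [etaTwoPowTwelve, ofComplex_apply_of_im_pos (by simpa using hx), etaTwelve,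
    Complex.ofReal_mul, Complex.ofReal_ofNat, mul_left_comm]

theorem lIntegralConverges_etaTwoPowTwelve (s : ℂ) : LIntegralConverges etaTwoPowTwelve s := by
  have h := (MellinConvergent.comp_mul_left (a := 2) two_pos).2 (mellinConvergent_etaTwelve s)
  refine h.congr_fun (fun x hx => ?_) measurableSet_Ioi
  simp only [etaTwoPowTwelve_I_mul hx]

theorem mellin_etaTwoPowTwelve (s : ℂ) :
    mellin (fun x : ℝ => etaTwoPowTwelve (ofComplex (Complex.I * x))) s =
      2 ^ (-s) * etaMellin s := by
  have h := mellin_comp_mul_left (fun y : ℝ => etaTwelve (Complex.I * y)) s two_pos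
  rw [smul_eq_mul, Complex.ofReal_ofNat] at h
  rw [etaMellin, ← h]
  refine setIntegral_congr_fun measurableSet_Ioi fun x hx => ?_
  simp only [etaTwoPowTwelve_I_mul hx]

theorem lValue_etaTwoPowTwelve :
    LValue etaTwoPowTwelve 5 =
      (π ^ 6 / 1024 * ∑' n : ℕ, wallisRatio n ^ 8 * (1 + 4 * n) : ℝ) := by
  have hΓ : Complex.Gamma 5 = 24 :=
    (Complex.Gamma_ofNat_eq_factorial 4).trans (by norm_num [Nat.factorial])
  have hcpow : (2 * (π : ℂ)) ^ (5 : ℂ) * 2 ^ (-5 : ℂ) = π ^ 5 := by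
    rw [Complex.cpow_neg, Complex.cpow_ofNat, Complex.cpow_ofNat]
    field
  have hfive := two_mul_etaMellin_five
  have hπ : (π : ℂ) ≠ 0 := by exact_mod_cast Real.pi_ne_zero
  rw [LValue, mellin_etaTwoPowTwelve, hΓ, div_mul_eq_mul_div, ← mul_assoc, hcpow,
    hasSum_wallisRatio_pow_eight.tsum_eq]
  rw [etaMellin_three] at hfive
  push_cast at hfive ⊢
  field_simp at hfive ⊢
  linear_combination 32 * hfive

theorem risingFactorial_zero (a : ℂ) : risingFactorial a 0 = 1 := by
  rw [risingFactorial, ascPochhammer_zero, Polynomial.eval_one]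

theorem risingFactorial_succ (a : ℂ) (n : ℕ) :
    risingFactorial a (n + 1) = risingFactorial a n * (a + n) := by
  rw [risingFactorial, risingFactorial, ascPochhammer_succ_eval]

theorem risingFactorial_one (n : ℕ) : risingFactorial 1 n = n ! := by
  rw [risingFactorial, ascPochhammer_eval_one]

theorem risingFactorial_half (n : ℕ) : risingFactorial (1 / 2) n = wallisRatio n * n ! := by
  induction n with
  | zero => simp [risingFactorial_zero]
  | succ n ih =>
    have h := congrArg Complex.ofReal (succ_mul_wallisRatio_succ n)
    push_cast at h
    rw [risingFactorial_succ, ih, Nat.factorial_succ]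
    push_cast
    linear_combination -(n ! : ℂ) * h

theorem risingFactorial_add_one_mul (a : ℂ) (n : ℕ) :
    a * risingFactorial (a + 1) n = (a + n) * risingFactorial a n := by
  induction n with
  | zero => simp [risingFactorial_zero]
  | succ n ih =>
    rw [risingFactorial_succ, risingFactorial_succ, ← mul_assoc, ih]
    push_cast
    ring

theorem risingFactorial_ofReal_ne_zero {a : ℝ} (ha : 0 < a) (n : ℕ) :
    risingFactorial a n ≠ 0 := by
  rw [risingFactorial, Ne, ascPochhammer_eval_eq_zero_iff]
  rintro ⟨k, _, hk⟩
  have hk : (k : ℝ) = -a := by exact_mod_cast hk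
  linarith [k.cast_nonneg (α := ℝ)]

theorem risingFactorial_div_pow_eight (n : ℕ) :
    risingFactorial (1 / 2) n ^ 8 / risingFactorial 1 n ^ 8 * (1 + 4 * (n : ℂ)) =
      (wallisRatio n ^ 8 * (1 + 4 * n) : ℝ) := by
  have h : (n ! : ℂ) ≠ 0 := by exact_mod_cast n.factorial_ne_zero
  rw [risingFactorial_half, risingFactorial_one]
  push_cast
  field

theorem hypergeometricTerm_eq (n : ℕ) :
    hypergeometricTerm {1 / 2, 1 / 2, 1 / 2, 1 / 2, 1 / 2, 1 / 2, 1 / 2, 1 / 2, 5 / 4}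
      {1, 1, 1, 1, 1, 1, 1, 1 / 4} 1 n =
    risingFactorial (1 / 2) n ^ 8 / risingFactorial 1 n ^ 8 * (1 + 4 * (n : ℂ)) := by
  have hfact : (n ! : ℂ) ≠ 0 := by exact_mod_cast n.factorial_ne_zero
  have hne := risingFactorial_ofReal_ne_zero (a := 1 / 4) (by norm_num) n
  have hshift := risingFactorial_add_one_mul (1 / 4) n
  norm_num at hne hshift
  have hfive : risingFactorial (5 / 4) n = (1 + 4 * n) * risingFactorial (1 / 4) n := by
    linear_combination 4 * hshift
  simp only [hypergeometricTerm, Multiset.insert_eq_cons, Multiset.map_cons,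
    Multiset.map_singleton, Multiset.prod_cons, Multiset.prod_singleton, one_pow]
  rw [hfive, risingFactorial_one]
  field

theorem mainTheorem7 :
    LIntegralConverges etaTwoPowTwelve 5 ∧
    Summable (fun n : ℕ =>
      risingFactorial (1 / 2) n ^ 8 / risingFactorial 1 n ^ 8 * (1 + 4 * (n : ℂ))) ∧
    Summable (hypergeometricTerm
      {1 / 2, 1 / 2, 1 / 2, 1 / 2, 1 / 2, 1 / 2, 1 / 2, 1 / 2, 5 / 4}
      {1, 1, 1, 1, 1, 1, 1, 1 / 4} 1) ∧
    LValue etaTwoPowTwelve 5 =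
      (π : ℂ) ^ 6 / 1024 * ∑' n : ℕ,
        risingFactorial (1 / 2) n ^ 8 / risingFactorial 1 n ^ 8 * (1 + 4 * (n : ℂ)) ∧
    LValue etaTwoPowTwelve 5 =
      (π : ℂ) ^ 6 / 1024 * hypergeometricPFQ
        {1 / 2, 1 / 2, 1 / 2, 1 / 2, 1 / 2, 1 / 2, 1 / 2, 1 / 2, 5 / 4}
        {1, 1, 1, 1, 1, 1, 1, 1 / 4} 1 := by
  have hs : Summable (fun n : ℕ =>
      risingFactorial (1 / 2) n ^ 8 / risingFactorial 1 n ^ 8 * (1 + 4 * (n : ℂ))) := by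
    simp only [risingFactorial_div_pow_eight]
    exact Complex.ofRealCLM.summable hasSum_wallisRatio_pow_eight.summable
  have hL : LValue etaTwoPowTwelve 5 = (π : ℂ) ^ 6 / 1024 * ∑' n : ℕ,
      risingFactorial (1 / 2) n ^ 8 / risingFactorial 1 n ^ 8 * (1 + 4 * (n : ℂ)) := by
    simp only [risingFactorial_div_pow_eight]
    exact_mod_cast lValue_etaTwoPowTwelve
  refine ⟨lIntegralConverges_etaTwoPowTwelve 5, hs,
    hs.congr fun n => (hypergeometricTerm_eq n).symm, hL, ?_⟩
  simp only [hL, hypergeometricPFQ, hypergeometricTerm_eq]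

end
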